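/- Let $\varphi:S^1\to S^1$ be an orientation-preserving homeomorphism of the circle $S^1=\{z\in\mathbb{C}:|z|=1\}$ with irrational rotation number $\varrho\in[0,1)\setminus\mathbb{Q}$, and let $\Phi:\mathbb{R}\to\mathbb{R}$ be a lift of $\varphi$ with respect to the covering $x\mapsto\exp(2\pi i x)$. For $x\in\mathbb{R}$ and $n\ge 0$ put $$z_n(x)=\sum_{k=0}^{n-1}\exp\bigl(2\pi i\,\Phi^k(x)\bigr),$$ and let $q_n$ be the denominator (in lowest terms) of the $n$-th convergent of the regular continued fraction expansion of $\varrho$. Suppose that for some $x_0\in\mathbb{R}$ the Birkhoff average $$\lim_{N\to\infty}\frac1N\sum_{k=0}^{N-1}\exp\bigl(2\pi i\,\Phi^k(x_0)\bigr)=c\in\mathbb{C}$$ exists (the value $c=0$ is allowed). Then there is a constant $M$ such that $$|z_{q_n}(x)-q_n c|\le M\qquad\text{for all } x\in\mathbb{R} \text{ and all } n\ge 0.$$ Moreover, if $\varphi$ is a $C^{1+bv}$ diffeomorphism, that is, a $C^1$ diffeomorphism whose derivative has bounded variation, then $z_{q_n}(x)-q_nc\to0$ uniformly in $x$: for every $\varepsilon>0$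 there is $N\in\mathbb{N}$ such that $|z_{q_n}(x)-q_nc|<\varepsilon$ for all $n>N$ and all $x\in\mathbb{R}$. -/

import Mathlib

namespace Curlicue

/-- The vertices `z_n = ∑_{k < n} exp (2 π i u_k)` of the curlicue generated by a real
sequence `u`. -/
noncomputable def vertex (u : ℕ → ℝ) (n : ℕ) : ℂ :=
  ∑ k ∈ Finset.range n, Complex.exp (2 * Real.pi * Complex.I * (u k : ℂ))

/-- The vertices `z_n(x)` of the curlicue generated by the orbit `x, Φ x, Φ² x, …`. -/
noncomputable def orbitVertex (Φ : ℝ → ℝ) (x : ℝ) (n : ℕ) : ℂ :=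
  vertex (fun k => Φ^[k] x) n

/-- `Φ` is a lift of the circle homeomorphism `φ` under the covering `x ↦ exp (2 π i x)`.
A `CircleDeg1Lift` is a monotone map with `Φ (x + 1) = Φ x + 1`, and a circle homeomorphism
preserves orientation precisely when its continuous lifts are of this kind, so that
`IsLift φ Φ` says that `φ` preserves orientation and that `Φ` is one of its lifts. -/
structure IsLift (φ : Circle ≃ₜ Circle) (Φ : CircleDeg1Lift) : Prop where
  continuous : Continuous Φ
  semiconj : ∀ x : ℝ, Circle.exp (2 * Real.pi * Φ x) = φ (Circle.exp (2 * Real.pi * x))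

/-- The rotation number, taken in `[0, 1)`, of the circle map with lift `Φ`: the class modulo `1`
of `lim (Φ^n x - x) / n`. It does not depend on the choice of the lift. -/
noncomputable def rotationNumber (Φ : CircleDeg1Lift) : ℝ :=
  Int.fract Φ.translationNumber

/-- The denominator `q_n` (in lowest terms) of the `n`-th convergent `[0; a_1, …, a_n]` of the
regular continued fraction of `ϱ ∈ [0, 1)`; in particular `q_0 = 1`. -/
noncomputable def convDen (ϱ : ℝ) (n : ℕ) : ℕ :=
  (ϱ.convergent n).den

/-- The circle map with lift `Φ` is a `C^{1+bv}` diffeomorphism: it is continuously differentiable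
with nowhere vanishing derivative (so that its inverse is continuously differentiable too), and its
derivative, a function on the circle, has bounded variation. Two lifts differ by an integer
constant, so this does not depend on the choice of the lift. -/
structure IsC1BVDiffeo (Φ : CircleDeg1Lift) : Prop where
  contDiff : ContDiff ℝ 1 Φ
  deriv_pos : ∀ x : ℝ, 0 < deriv Φ x
  boundedVariation : BoundedVariationOn (deriv Φ) (Set.Icc 0 1)

end Curlicue

/-!
The average `c` enters only through `norm_orbitVertex_sub_mul_le`: along the orbit of `x₀` the
averages of `z_q` tend to `q c`, so `|z_q(x) - q c|` is at most the oscillation of `z_q`. It remains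
to bound `z_q(x) - z_q(y)` for `q = q_n`, and no invariant measure is needed.

Poincaré's semiconjugacy `h` with the rotation by `τ`, and `|τ - p / q| ≤ 1 / q ^ 2`, place `Φ^k x`
for `k < q` within a bounded number of steps of the point of index `i + k p` among the points
`h (j / q)`. As `k` runs through `0, …, q - 1` these indices run through all residues modulo `q`,
which gives the Denjoy–Koksma inequality `DegreeControl.norm_birkhoff_sub_le`: the oscillation of a
Birkhoff sum of length `q` is at most a constant times the variation of the observable. Applied to
`exp (2 π i x)` this is the boundedness.

For a `C^{1+bv}` diffeomorphism the observable is a coboundary up to a function of arbitrarily small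
variation. On derivatives, the claim is that every density of mean zero is a limit in mean of
coboundaries `(g ∘ Φ) Φ' - g` (`IsC1BVDiffeo.exists_coboundary_approx`). This rests on a Doeblin
argument. By Denjoy's theorem `h` is a homeomorphism, so densities are approximated by step functions
on short arcs that have angular width of order `1 / q`. The preimages of such an arc under the first
`q` iterates cover the circle with bounded multiplicity and bounded distortion, so a suitable average
of the translates of its indicator is bounded below by a definite proportion of its length
(`IsC1BVDiffeo.exists_minorization`). For a density of mean zero the lower bounds cancel, so that its
distance to the coboundaries is at most `1 - δ` times its norm. The estimate applies again to the
difference with any coboundary; hence the distance is zero.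

The Birkhoff sum over `G ∘ Φ - G` is `G ∘ Φ^q - G`, which is constant up to `o(1)` because
`Φ^{q_n} - p_n` tends to the identity uniformly, and the rest is small by the Denjoy–Koksma
inequality.
-/

namespace Curlicue

open Finset Filter Topology MeasureTheory

/-! ### Rational approximations and residues -/

/-- `v` is monotone and increases by `V` over every period. Such a `v` plays the role of the
variation function of a periodic observable of total variation `V`; the bounds on Birkhoff sums
below use only the increments of `v`. -/
structure DegreeControl (v : ℝ → ℝ) (V : ℝ) : Prop where
  mono : Monotone v
  map_add_one : ∀ x, v (x + 1) = v x + V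

/-- The fraction `p / q` is reduced and satisfies `|τ - p / q| ≤ 1 / q ^ 2`, the only property of
convergents that the argument needs (together with `q → ∞`). -/
structure RotApprox (τ : ℝ) (q : ℕ) (p : ℤ) : Prop where
  pos : 0 < q
  coprime : IsCoprime p (q : ℤ)
  abs_mul_sub_le : |q * τ - p| ≤ 1 / q

/-- The point `x` lies at angle `θ` in the coordinate of the semiconjugacy `h`. Since `h` may jump,
`x` need not be a value of `h`; it lies in the closed gap between the one-sided limits of `h`
at `θ`. -/
def AtAngle (h : CircleDeg1Lift) (θ x : ℝ) : Prop :=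
  ∀ ε : ℝ, 0 < ε → h (θ - ε) ≤ x ∧ x ≤ h (θ + ε)

lemma periodic_int_emod {E : Type*} {q : ℕ} {g : ℤ → E} (hg : ∀ i, g (i + q) = g i) (i : ℤ) :
    g (i % q) = g i := by
  have h : Function.Periodic g (q : ℤ) := hg
  have := h.sub_zsmul_eq (x := i) (i / q)
  rw [← this, Int.emod_def, smul_eq_mul, mul_comm]

/-- The numbers `i₀ + k p` with `k < q` represent every residue class modulo `q` once. -/
lemma sum_range_residues {E : Type*} [AddCommMonoid E] {q : ℕ} {p : ℤ} (hq : 0 < q)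
    (hp : IsCoprime p (q : ℤ)) {g : ℤ → E} (hg : ∀ i, g (i + q) = g i) (i₀ : ℤ) :
    ∑ k ∈ range q, g (i₀ + k * p) = ∑ k ∈ range q, g k := by
  have hq' : (0 : ℤ) < q := by exact_mod_cast hq
  set σ : ℕ → ℕ := fun k => ((i₀ + k * p) % q).toNat with hσ
  have hσc : ∀ k, ((σ k : ℕ) : ℤ) = (i₀ + k * p) % q := fun k =>
    Int.toNat_of_nonneg (Int.emod_nonneg _ hq'.ne')
  have hinj : Set.InjOn σ (range q : Set ℕ) := by
    intro a ha b hb hab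
    have h1 : (i₀ + a * p) % q = (i₀ + b * p) % q := by rw [← hσc, ← hσc, hab]
    have h2 : (q : ℤ) ∣ ((b : ℤ) - a) * p := by
      have h3 := Int.ModEq.dvd h1
      convert h3 using 1
      ring
    have h3 : (q : ℤ) ∣ (b : ℤ) - a := hp.symm.dvd_of_dvd_mul_right h2
    have ha := Finset.mem_range.1 (Finset.mem_coe.1 ha)
    have hb := Finset.mem_range.1 (Finset.mem_coe.1 hb)
    have h4 : (b : ℤ) - a = 0 := by
      apply Int.eq_zero_of_abs_lt_dvd h3
      rw [abs_lt]; omega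
    omega
  have himg : (range q).image σ = range q := by
    apply Finset.eq_of_subset_of_card_le
    · intro j hj
      obtain ⟨k, -, rfl⟩ := Finset.mem_image.1 hj
      have := Int.emod_lt_of_pos (i₀ + k * p) hq'
      rw [← hσc] at this
      exact Finset.mem_range.2 (by exact_mod_cast this)
    · rw [Finset.card_image_of_injOn hinj]
  conv_rhs => rw [← himg]
  rw [Finset.sum_image hinj]
  refine Finset.sum_congr rfl fun k _ => ?_
  rw [hσc, periodic_int_emod hg]

/-! ### Orbits of length `q` and the Denjoy–Koksma inequality -/

section Koksma

variable {Φ h : CircleDeg1Lift} {τ : ℝ} {q : ℕ} {p : ℤ} {v : ℝ → ℝ} {V : ℝ}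

lemma exists_atAngle (h : CircleDeg1Lift) (x : ℝ) : ∃ θ, AtAngle h θ x := by
  have hne : {s | h s ≤ x}.Nonempty := by
    obtain ⟨s, hs⟩ := (h.tendsto_atBot.eventually (Filter.eventually_le_atBot x)).exists
    exact ⟨s, hs⟩
  have hbd : BddAbove {s | h s ≤ x} := by
    obtain ⟨s, hs⟩ := (h.tendsto_atTop.eventually (Filter.eventually_gt_atTop x)).exists
    refine ⟨s, fun t ht => ?_⟩
    by_contra hlt
    exact absurd (h.monotone (not_le.1 hlt).le) (not_le.2 (lt_of_le_of_lt ht hs))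
  refine ⟨sSup {s | h s ≤ x}, fun ε hε => ⟨?_, ?_⟩⟩
  · obtain ⟨s, hs, hlt⟩ := exists_lt_of_lt_csSup hne (sub_lt_self _ hε)
    exact (h.monotone hlt.le).trans hs
  · by_contra hlt
    have := le_csSup hbd (show sSup {s | h s ≤ x} + ε ∈ {s | h s ≤ x} from (not_le.1 hlt).le)
    linarith

lemma atAngle_apply (h : CircleDeg1Lift) (θ : ℝ) : AtAngle h θ (h θ) := fun ε hε =>
  ⟨h.monotone (by linarith), h.monotone (by linarith)⟩

lemma iterate_semiconj (hΦ : ∀ s, Φ (h s) = h (s + τ)) (k : ℕ) (s : ℝ) :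
    Φ^[k] (h s) = h (s + k * τ) := by
  induction k with
  | zero => simp
  | succ k ih => rw [Function.iterate_succ_apply', ih, hΦ]; push_cast; ring_nf

lemma AtAngle.iterate (hΦ : ∀ s, Φ (h s) = h (s + τ)) {θ x : ℝ} (hx : AtAngle h θ x) (k : ℕ) :
    AtAngle h (θ + k * τ) (Φ^[k] x) := by
  intro ε hε
  obtain ⟨h1, h2⟩ := hx ε hε
  have h1' := Φ.monotone.iterate k h1
  have h2' := Φ.monotone.iterate k h2
  rw [iterate_semiconj hΦ] at h1' h2'
  exact ⟨by rwa [show θ + k * τ - ε = θ - ε + k * τ by ring],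
    by rwa [show θ + k * τ + ε = θ + ε + k * τ by ring]⟩

lemma iterate_add_one (Φ : CircleDeg1Lift) (k : ℕ) (x : ℝ) : Φ^[k] (x + 1) = Φ^[k] x + 1 := by
  rw [← CircleDeg1Lift.coe_pow, CircleDeg1Lift.map_add_one]

lemma iterate_add_int (Φ : CircleDeg1Lift) (k : ℕ) (x : ℝ) (n : ℤ) :
    Φ^[k] (x + n) = Φ^[k] x + n := by
  rw [← CircleDeg1Lift.coe_pow, CircleDeg1Lift.map_add_int]

lemma RotApprox.abs_mul_le (H : RotApprox τ q p) {k : ℕ} (hk : k ≤ q) :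
    |k * τ - k * p / q| ≤ 1 / q := by
  have hq : (0 : ℝ) < q := by exact_mod_cast H.pos
  have hk' : (k : ℝ) / q ≤ 1 := by rw [div_le_one hq]; exact_mod_cast hk
  have : k * τ - k * p / q = (k / q : ℝ) * (q * τ - p) := by field_simp
  rw [this, abs_mul, abs_of_nonneg (by positivity)]
  calc (k / q : ℝ) * |q * τ - p| ≤ 1 * (1 / q) := by
        gcongr
        exact H.abs_mul_sub_le
    _ = _ := one_mul _

/-- The first `q` points of the orbit of `x` follow the points `h (j / q)`, up to a bounded number
of indices: `Φ^k x` stays near index `i + k p`. -/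
lemma AtAngle.window (hΦ : ∀ s, Φ (h s) = h (s + τ)) (H : RotApprox τ q p) {θ x : ℝ}
    (hx : AtAngle h θ x) {i : ℤ} {r : ℕ} (hi : |θ * q - i| ≤ r) {k : ℕ} (hk : k ≤ q) :
    h (((i + k * p - (r + 2) : ℤ) : ℝ) / q) ≤ Φ^[k] x ∧
      Φ^[k] x ≤ h (((i + k * p + (r + 2) : ℤ) : ℝ) / q) := by
  have hq : (0 : ℝ) < q := by exact_mod_cast H.pos
  have hkx := hx.iterate hΦ k (1 / q) (by positivity)
  have h1 := abs_le.1 (H.abs_mul_le hk)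
  have h2 := abs_le.1 hi
  have e1 : (θ + k * τ) * q = θ * q + k * p + (k * τ - k * p / q) * q := by field_simp; ring
  have b1 : (k * τ - k * p / q) * q ≤ 1 := by
    have := mul_le_mul_of_nonneg_right h1.2 hq.le
    rwa [div_mul_cancel₀ _ hq.ne'] at this
  have b2 : -1 ≤ (k * τ - k * p / q) * q := by
    have := mul_le_mul_of_nonneg_right h1.1 hq.le
    rwa [neg_mul, div_mul_cancel₀ _ hq.ne'] at this
  constructor
  · refine (h.monotone ?_).trans hkx.1
    rw [div_le_iff₀ hq, sub_mul, div_mul_cancel₀ _ hq.ne', e1]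
    push_cast
    linarith [h2.1]
  · refine hkx.2.trans (h.monotone ?_)
    rw [le_div_iff₀ hq, add_mul (θ + k * τ), div_mul_cancel₀ _ hq.ne', e1]
    push_cast
    linarith [h2.2]

/-- The increments of `v` over the windows of `2 m` consecutive points `h (j / q)` centred at the
indices `i + k p` add up to `2 m` periods: the indices exhaust the residues modulo `q`, and the sum
telescopes. -/
lemma DegreeControl.sum_window (hv : DegreeControl v V) (h : CircleDeg1Lift) (hq : 0 < q)
    (hp : IsCoprime p (q : ℤ)) (i : ℤ) (m : ℕ) :
    ∑ k ∈ range q, (v (h (((i + k * p + m : ℤ) : ℝ) / q))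
      - v (h (((i + k * p - m : ℤ) : ℝ) / q))) = 2 * m * V := by
  have hq0 : (q : ℝ) ≠ 0 := by positivity
  set y : ℤ → ℝ := fun j => v (h ((j : ℝ) / q)) with hy
  have hyq : ∀ j, y (j + q) = y j + V := by
    intro j
    simp only [hy]
    rw [show (((j + q : ℤ) : ℝ) / q) = (j : ℝ) / q + 1 by push_cast; field_simp,
      CircleDeg1Lift.map_add_one, hv.map_add_one]
  have hshift : ∀ n : ℕ, ∀ a : ℤ, ∑ k ∈ range q, (y (k + a + n) - y (k + a)) = n * V := by
    intro n a
    induction n with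
    | zero => simp
    | succ n ih =>
      have h1 : ∑ k ∈ range q, (y (k + a + (n + 1 : ℕ)) - y (k + a + n)) = V := by
        have := Finset.sum_range_sub (fun k : ℕ => y (k + a + n)) q
        simp only [Nat.cast_add, Nat.cast_one] at this ⊢
        rw [show ((q : ℤ) + a + n) = (((0 : ℕ) : ℤ) + a + n) + q by push_cast; ring, hyq] at this
        rw [add_sub_cancel_left] at this
        rw [← this]
        refine Finset.sum_congr rfl fun k _ => ?_
        ring_nf
      have : ∀ k : ℕ, y (k + a + (n + 1 : ℕ)) - y (k + a)
          = (y (k + a + (n + 1 : ℕ)) - y (k + a + n)) + (y (k + a + n) - y (k + a)) := by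
        intro k; ring
      rw [Finset.sum_congr rfl fun k _ => this k, Finset.sum_add_distrib, h1, ih]
      push_cast; ring
  have hper := sum_range_residues hq hp (g := fun j => y (j + m) - y (j - m)) (by
    intro j
    rw [show j + q + m = j + m + q by ring, show j + q - (m : ℤ) = j - m + q by ring, hyq, hyq]
    ring) i
  simp only [hy] at hper hshift ⊢
  rw [hper]
  have := hshift (2 * m) (-m)
  push_cast at this ⊢
  rw [← this]
  refine Finset.sum_congr rfl fun k _ => ?_
  ring_nf

lemma DegreeControl.abs_sub_le (hv : DegreeControl v V) {a b x y : ℝ} (hx : x ∈ Set.Icc a b)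
    (hy : y ∈ Set.Icc a b) : |v x - v y| ≤ v b - v a := by
  rw [abs_le]
  constructor <;> linarith [hv.mono hx.1, hv.mono hx.2, hv.mono hy.1, hv.mono hy.2]

/-- Two orbits at angles `O(1 / q)` apart stay so close for the time `q` that the increments of `v`
between them have a sum independent of `q`. -/
lemma DegreeControl.sum_abs_sub_le (hv : DegreeControl v V) (hΦ : ∀ s, Φ (h s) = h (s + τ))
    (H : RotApprox τ q p) {θ θ' x x' : ℝ} (hx : AtAngle h θ x) (hx' : AtAngle h θ' x') {r : ℕ}
    (hr : |θ - θ'| ≤ r / q) :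
    ∑ k ∈ range q, |v (Φ^[k] x) - v (Φ^[k] x')| ≤ 2 * (r + 3) * V := by
  have hq : (0 : ℝ) < q := by exact_mod_cast H.pos
  have h0 : |θ * q - ⌊θ * q⌋| ≤ (1 : ℕ) := by
    rw [abs_le]; constructor <;> push_cast <;>
      linarith [Int.floor_le (θ * q), Int.lt_floor_add_one (θ * q)]
  have h1 : |θ * q - ⌊θ * q⌋| ≤ (r + 1 : ℕ) := h0.trans (by push_cast; simp)
  have h2 : |θ' * q - ⌊θ * q⌋| ≤ (r + 1 : ℕ) := by
    have e : |θ' * q - θ * q| ≤ r := by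
      rw [← sub_mul, abs_mul, abs_of_pos hq, abs_sub_comm]
      rwa [le_div_iff₀ hq] at hr
    calc |θ' * q - ⌊θ * q⌋| = |(θ' * q - θ * q) + (θ * q - ⌊θ * q⌋)| := by ring_nf
      _ ≤ r + (1 : ℕ) := (abs_add_le _ _).trans (add_le_add e h0)
      _ = _ := by push_cast; ring
  have hs := hv.sum_window h H.pos H.coprime ⌊θ * q⌋ (r + 3)
  push_cast at hs
  rw [← hs]
  refine Finset.sum_le_sum fun k hk => ?_
  have hk' := (Finset.mem_range.1 hk).le
  have w1 := hx.window hΦ H h1 hk'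
  have w2 := hx'.window hΦ H h2 hk'
  have e : ((r + 1 : ℕ) : ℤ) + 2 = r + 3 := by push_cast; ring
  rw [e] at w1 w2
  have := hv.abs_sub_le w1 w2
  push_cast at this
  exact this

/-- The **Denjoy–Koksma inequality**, without the invariant measure: any two Birkhoff sums of length
`q` differ by a bounded multiple of the variation. Both are compared with the sum over the points
`h (j / q)`. -/
lemma DegreeControl.norm_birkhoff_sub_le {E : Type*} [NormedAddCommGroup E]
    (hv : DegreeControl v V) (hΦ : ∀ s, Φ (h s) = h (s + τ)) (H : RotApprox τ q p) {f : ℝ → E}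
    (hper : ∀ x, f (x + 1) = f x) (hf : ∀ x y, ‖f x - f y‖ ≤ |v x - v y|) (x x' : ℝ) :
    ‖∑ k ∈ range q, f (Φ^[k] x) - ∑ k ∈ range q, f (Φ^[k] x')‖ ≤ 12 * V := by
  have hq : (0 : ℝ) < q := by exact_mod_cast H.pos
  have key : ∀ x, ‖∑ k ∈ range q, f (Φ^[k] x) - ∑ k ∈ range q, f (h (k / q))‖ ≤ 6 * V := by
    intro x
    obtain ⟨θ, hθ⟩ := exists_atAngle h x
    have h0 : |θ * q - ⌊θ * q⌋| ≤ (1 : ℕ) := by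
      rw [abs_le]; constructor <;> push_cast <;>
        linarith [Int.floor_le (θ * q), Int.lt_floor_add_one (θ * q)]
    have hres := sum_range_residues H.pos H.coprime (g := fun j : ℤ => f (h ((j : ℝ) / q)))
      (fun j => by
        rw [show (((j + q : ℤ) : ℝ) / q) = (j : ℝ) / q + 1 by push_cast; field_simp,
          CircleDeg1Lift.map_add_one, hper]) ⌊θ * q⌋
    simp only [Int.cast_natCast] at hres
    rw [← hres, ← Finset.sum_sub_distrib]
    have hs := hv.sum_window h H.pos H.coprime ⌊θ * q⌋ 3
    rw [show (2 * (3 : ℕ) * V : ℝ) = 6 * V by push_cast; ring] at hs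
    rw [← hs]
    refine (norm_sum_le _ _).trans (Finset.sum_le_sum fun k hk => ?_)
    have w := hθ.window hΦ H h0 (Finset.mem_range.1 hk).le
    refine (hf _ _).trans (hv.abs_sub_le ?_ ?_)
    · exact w
    · constructor <;>
        exact h.monotone (div_le_div_of_nonneg_right (Int.cast_le.2 (by push_cast; omega)) hq.le)
  calc _ = ‖(∑ k ∈ range q, f (Φ^[k] x) - ∑ k ∈ range q, f (h (k / q)))
        - (∑ k ∈ range q, f (Φ^[k] x') - ∑ k ∈ range q, f (h (k / q)))‖ := by
        congr 1; abel
    _ ≤ 6 * V + 6 * V := (norm_sub_le _ _).trans (add_le_add (key x) (key x'))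
    _ = _ := by ring

end Koksma

/-! ### Convergents of the rotation number -/

section Convergents

open GenContFract in
lemma not_terminatedAt_of_irrational {ξ : ℝ} (hξ : Irrational ξ) (n : ℕ) :
    ¬ (GenContFract.of ξ).TerminatedAt n := by
  intro h
  obtain ⟨r, hr⟩ := (terminates_iff_rat ξ).1 ⟨n, h⟩
  exact hξ ⟨r, hr.symm⟩

open GenContFract in
lemma exists_int_contsAux {ξ : ℝ} (hξ : Irrational ξ) (n : ℕ) :
    (∃ A B : ℤ, (GenContFract.of ξ).contsAux n = ⟨A, B⟩) ∧
      ∃ A B : ℤ, (GenContFract.of ξ).contsAux (n + 1) = ⟨A, B⟩ := by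
  induction n with
  | zero => exact ⟨⟨1, 0, by simp [contsAux]⟩, ⟨⌊ξ⌋, 1, by simp [contsAux, of_h_eq_floor]⟩⟩
  | succ n ih =>
    refine ⟨ih.2, ?_⟩
    obtain ⟨⟨A, B, h0⟩, ⟨A', B', h1⟩⟩ := ih
    obtain ⟨gp, hgp⟩ := Option.ne_none_iff_exists'.1 (not_terminatedAt_of_irrational hξ n)
    obtain ⟨ha, b, hb⟩ := of_partNum_eq_one_and_exists_int_partDen_eq hgp
    refine ⟨b * A' + A, b * B' + B, ?_⟩
    rw [contsAux_recurrence hgp h0 h1, ha, hb]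
    simp

/-- The error bound for convergents in terms of the *reduced* denominator; the continuants `dens n`
of the generalized continued fraction are integral multiples of it, which suffices. -/
lemma abs_mul_convDen_sub_le {ξ : ℝ} (hξ : Irrational ξ) (n : ℕ) :
    |convDen ξ n * ξ - (ξ.convergent n).num| ≤ 1 / convDen ξ n := by
  obtain ⟨A, B, hAB⟩ := (exists_int_contsAux hξ n).2
  have hnum : (GenContFract.of ξ).nums n = A := by
    rw [GenContFract.num_eq_conts_a, GenContFract.nth_cont_eq_succ_nth_contAux, hAB]
  have hden : (GenContFract.of ξ).dens n = B := by
    rw [GenContFract.den_eq_conts_b, GenContFract.nth_cont_eq_succ_nth_contAux, hAB]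
  have hle := GenContFract.abs_sub_convs_le (not_terminatedAt_of_irrational hξ n)
  have hmono := GenContFract.of_den_mono (v := ξ) (n := n)
  have hpos : (1 : ℝ) ≤ B := by
    have := GenContFract.succ_nth_fib_le_of_nth_den (v := ξ) (n := n)
      (Or.inr (not_terminatedAt_of_irrational hξ _))
    rw [hden] at this
    refine le_trans ?_ this
    exact_mod_cast Nat.fib_pos.2 n.succ_pos
  have hconv : (GenContFract.of ξ).convs n = A / B := by
    rw [GenContFract.conv_eq_num_div_den, hnum, hden]
  have hrat : ξ.convergent n = A / B := by
    have := Real.convs_eq_convergent ξ n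
    rw [hconv] at this
    exact_mod_cast this.symm
  -- the reduced denominator divides `B`
  have hdvd : ((ξ.convergent n).den : ℤ) ∣ B := by
    rw [hrat, ← Rat.divInt_eq_div]
    exact Rat.den_dvd A B
  have hB : (0 : ℤ) < B := by
    have : (0 : ℝ) < B := by linarith
    exact_mod_cast this
  have hdle : (convDen ξ n : ℝ) ≤ B := by
    have := Int.le_of_dvd hB hdvd
    unfold convDen
    exact_mod_cast this
  have hd0 : (0 : ℝ) < convDen ξ n := by
    unfold convDen
    exact_mod_cast (ξ.convergent n).den_pos
  rw [Real.convs_eq_convergent, hden] at hle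
  have hle' : |ξ - ξ.convergent n| ≤ 1 / (convDen ξ n * convDen ξ n) := by
    refine hle.trans ?_
    rw [hden] at hmono
    gcongr
    exact hdle.trans hmono
  have e : convDen ξ n * ξ - (ξ.convergent n).num = convDen ξ n * (ξ - ξ.convergent n) := by
    have : ((ξ.convergent n : ℚ) : ℝ) = (ξ.convergent n).num / convDen ξ n := by
      rw [Rat.cast_def]; rfl
    rw [this]
    field_simp
  rw [e, abs_mul, abs_of_pos hd0]
  calc (convDen ξ n : ℝ) * |ξ - ξ.convergent n|
      ≤ convDen ξ n * (1 / (convDen ξ n * convDen ξ n)) := by gcongr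
    _ = _ := by field_simp

lemma tendsto_convDen {ξ : ℝ} (hξ : Irrational ξ) : Tendsto (convDen ξ) atTop atTop := by
  rw [tendsto_atTop]
  intro N
  obtain ⟨ε, hε, hε0⟩ := ((hξ.eventually_forall_le_dist_cast_rat_of_den_le N).filter_mono
    nhdsWithin_le_nhds |>.and (self_mem_nhdsWithin : Set.Ioi (0 : ℝ) ∈ 𝓝[>] 0)).exists
  have hconv : Tendsto (fun n => ((ξ.convergent n : ℚ) : ℝ)) atTop (𝓝 ξ) := by
    have := GenContFract.of_convergence ξ
    simpa only [funext (Real.convs_eq_convergent ξ)] using this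
  filter_upwards [Metric.tendsto_nhds.1 hconv ε hε0] with n hn
  by_contra hlt
  have := hε (ξ.convergent n) (not_le.1 hlt).le
  rw [dist_comm] at this
  linarith

lemma exists_rotApprox_convDen {τ : ℝ} (hτ : Irrational (Int.fract τ)) (n : ℕ) :
    ∃ p, RotApprox τ (convDen (Int.fract τ) n) p := by
  set ξ := Int.fract τ with hξ
  refine ⟨(ξ.convergent n).num + ⌊τ⌋ * convDen ξ n, (ξ.convergent n).den_pos, ?_, ?_⟩
  · have : IsCoprime (ξ.convergent n).num ((convDen ξ n : ℕ) : ℤ) :=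
      Int.isCoprime_iff_gcd_eq_one.2 (ξ.convergent n).reduced
    exact this.add_mul_right_left _
  · convert abs_mul_convDen_sub_le hτ n using 2
    rw [hξ, Int.fract]
    push_cast
    ring

end Convergents

/-! ### Semiconjugacy to the rotation -/

section Lift

variable {φ : Circle ≃ₜ Circle} {Φ : CircleDeg1Lift}

lemma IsLift.injective (hΦ : IsLift φ Φ) : Function.Injective Φ := by
  intro x y hxy
  have h : Circle.exp (2 * Real.pi * x) = Circle.exp (2 * Real.pi * y) :=
    φ.injective (by rw [← hΦ.semiconj, ← hΦ.semiconj, hxy])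
  obtain ⟨m, hm⟩ := Circle.exp_eq_exp.1 h
  have hm' : x = y + m := by
    have := Real.two_pi_pos
    have : 2 * Real.pi * (x - (y + m)) = 0 := by linarith
    rcases mul_eq_zero.1 this with h | h <;> linarith
  rw [hm', CircleDeg1Lift.map_add_int] at hxy
  rw [hm']
  linarith

/-- Poincaré's semiconjugacy, in the direction in which it sends the rotation to `Φ`: this `h` is
monotone, but possibly discontinuous. -/
lemma IsLift.exists_semiconj (hΦ : IsLift φ Φ) :
    ∃ h : CircleDeg1Lift, ∀ s, Φ (h s) = h (s + Φ.translationNumber) := by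
  set T : CircleDeg1Lift :=
    ((CircleDeg1Lift.translate (Multiplicative.ofAdd Φ.translationNumber) : CircleDeg1Liftˣ) :
      CircleDeg1Lift)
  have hT : ∀ x, T x = Φ.translationNumber + x := fun x => by
    simp [T]
  obtain ⟨h, hh⟩ := CircleDeg1Lift.semiconj_of_bijective_of_translationNumber_eq (f₁ := T)
    (f₂ := Φ) ⟨fun x y hxy => by simpa [hT] using hxy, fun x => ⟨x - Φ.translationNumber, by
      rw [hT]; ring⟩⟩
    ⟨hΦ.injective, Φ.continuous_iff_surjective.1 hΦ.continuous⟩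
    (CircleDeg1Lift.translationNumber_translate _)
  refine ⟨h, fun s => ?_⟩
  rw [← hh, hT, add_comm]

end Lift

/-! ### Vertices of the curlicue -/

section Vertex

/-- The observable `x ↦ exp (2 π i x)` whose Birkhoff sums are the vertices of the curlicue. -/
noncomputable def unitExp (x : ℝ) : ℂ := Complex.exp (2 * Real.pi * Complex.I * (x : ℂ))

lemma orbitVertex_eq (Φ : ℝ → ℝ) (x : ℝ) (n : ℕ) :
    orbitVertex Φ x n = ∑ k ∈ range n, unitExp (Φ^[k] x) := rfl

lemma unitExp_eq (x : ℝ) : unitExp x = Complex.exp (((2 * Real.pi * x : ℝ) : ℂ) * Complex.I) := by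
  unfold unitExp; push_cast; ring_nf

lemma norm_unitExp (x : ℝ) : ‖unitExp x‖ = 1 := by
  rw [unitExp_eq, Complex.norm_exp_ofReal_mul_I]

lemma unitExp_add_one (x : ℝ) : unitExp (x + 1) = unitExp x := by
  unfold unitExp
  push_cast
  rw [mul_add, mul_one, Complex.exp_add, Complex.exp_two_pi_mul_I, mul_one]

lemma norm_unitExp_sub_le (x y : ℝ) : ‖unitExp x - unitExp y‖ ≤ 2 * Real.pi * |x - y| := by
  have h1 : unitExp x - unitExp y
      = unitExp y * (Complex.exp (Complex.I * ((2 * Real.pi * (x - y) : ℝ) : ℂ)) - 1) := by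
    rw [mul_sub, mul_one, unitExp, unitExp, ← Complex.exp_add]
    congr 2
    push_cast; ring
  rw [h1, norm_mul, norm_unitExp, one_mul]
  refine (Real.norm_exp_I_mul_ofReal_sub_one_le).trans ?_
  rw [Real.norm_eq_abs, abs_mul, abs_of_pos Real.two_pi_pos]

lemma norm_orbitVertex_le (Φ : ℝ → ℝ) (x : ℝ) (n : ℕ) : ‖orbitVertex Φ x n‖ ≤ n := by
  rw [orbitVertex_eq]
  refine (norm_sum_le _ _).trans ?_
  simp [norm_unitExp]

lemma orbitVertex_add (Φ : ℝ → ℝ) (x : ℝ) (m n : ℕ) :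
    orbitVertex Φ x (m + n) = orbitVertex Φ x m + orbitVertex Φ (Φ^[m] x) n := by
  simp only [orbitVertex_eq, Finset.sum_range_add, ← Function.iterate_add_apply, add_comm]

/-- Interchanging the two summations, both terms are sums of `q` vertices `z_N` along the orbit,
and `z_N (Φ^j x) - z_N x` involves only `2 j` terms of the orbit. -/
lemma norm_sum_orbitVertex_sub_le (Φ : ℝ → ℝ) (x : ℝ) (q N : ℕ) :
    ‖∑ k ∈ range N, orbitVertex Φ (Φ^[k] x) q - q * orbitVertex Φ x N‖ ≤ 2 * q * q := by
  have h1 : ∑ k ∈ range N, orbitVertex Φ (Φ^[k] x) q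
      = ∑ j ∈ range q, orbitVertex Φ (Φ^[j] x) N := by
    simp only [orbitVertex_eq]
    rw [Finset.sum_comm]
    refine Finset.sum_congr rfl fun j _ => Finset.sum_congr rfl fun k _ => ?_
    rw [← Function.iterate_add_apply, ← Function.iterate_add_apply, add_comm]
  have h2 : (q : ℂ) * orbitVertex Φ x N = ∑ j ∈ range q, orbitVertex Φ x N := by simp
  rw [h1, h2, ← Finset.sum_sub_distrib]
  refine (norm_sum_le _ _).trans ?_
  calc ∑ j ∈ range q, ‖orbitVertex Φ (Φ^[j] x) N - orbitVertex Φ x N‖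
      ≤ ∑ j ∈ range q, (2 * q : ℝ) := by
        refine Finset.sum_le_sum fun j hj => ?_
        have hj : (j : ℝ) ≤ q := by exact_mod_cast (Finset.mem_range.1 hj).le
        have e1 := orbitVertex_add Φ x j N
        have e2 := orbitVertex_add Φ x N j
        rw [add_comm] at e2
        have : orbitVertex Φ (Φ^[j] x) N - orbitVertex Φ x N
            = orbitVertex Φ (Φ^[N] x) j - orbitVertex Φ x j := by
          rw [sub_eq_sub_iff_add_eq_add, add_comm, ← e1, e2, add_comm]
        rw [this]
        refine (norm_sub_le _ _).trans ?_
        linarith [norm_orbitVertex_le Φ (Φ^[N] x) j, norm_orbitVertex_le Φ x j]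
    _ = 2 * q * q := by simp; ring

/-- A bound on the oscillation of `z_q` bounds its distance to `q c`, because `q c` is the limit of
the averages of `z_q` along the orbit of `x₀`. -/
lemma norm_orbitVertex_sub_mul_le {Φ : ℝ → ℝ} {x₀ : ℝ} {c : ℂ}
    (hc : Tendsto (fun N : ℕ => (1 / (N : ℂ)) * orbitVertex Φ x₀ N) atTop (𝓝 c)) {q : ℕ} {B : ℝ}
    (hB : ∀ x y, ‖orbitVertex Φ x q - orbitVertex Φ y q‖ ≤ B) (x : ℝ) :
    ‖orbitVertex Φ x q - q * c‖ ≤ B := by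
  have hlim : Tendsto (fun N : ℕ => B + 2 * q * q * (1 / (N : ℝ))) atTop
      (𝓝 (B + 2 * q * q * 0)) :=
    (tendsto_one_div_atTop_nhds_zero_nat.const_mul _).const_add _
  rw [mul_zero, add_zero] at hlim
  have hlim' : Tendsto (fun N : ℕ => ‖orbitVertex Φ x q - q * ((1 / (N : ℂ)) * orbitVertex Φ x₀ N)‖)
      atTop (𝓝 ‖orbitVertex Φ x q - q * c‖) := ((hc.const_mul _).const_sub _).norm
  refine le_of_tendsto_of_tendsto hlim' hlim ?_
  filter_upwards [eventually_gt_atTop 0] with N hN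
  have hN' : (0 : ℝ) < N := by exact_mod_cast hN
  have hN'' : (N : ℂ) ≠ 0 := by exact_mod_cast hN.ne'
  have e : orbitVertex Φ x q - q * ((1 / (N : ℂ)) * orbitVertex Φ x₀ N)
      = (1 / (N : ℂ)) * (∑ k ∈ range N, (orbitVertex Φ x q - orbitVertex Φ (Φ^[k] x₀) q)
        + (∑ k ∈ range N, orbitVertex Φ (Φ^[k] x₀) q - q * orbitVertex Φ x₀ N)) := by
    rw [Finset.sum_sub_distrib, Finset.sum_const, card_range, nsmul_eq_mul]
    field_simp
    ring
  rw [e, norm_mul, norm_div, norm_one, Complex.norm_natCast]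
  calc 1 / (N : ℝ) * ‖_‖ ≤ 1 / (N : ℝ) * (N * B + 2 * q * q) := by
        gcongr
        refine (norm_add_le _ _).trans (add_le_add ?_ (norm_sum_orbitVertex_sub_le Φ x₀ q N))
        refine (norm_sum_le _ _).trans ?_
        refine (Finset.sum_le_sum fun k _ => hB x _).trans ?_
        simp
    _ = _ := by field_simp

lemma norm_orbitVertex_sub_le {Φ h : CircleDeg1Lift} {τ : ℝ} (hΦ : ∀ s, Φ (h s) = h (s + τ))
    {q : ℕ} {p : ℤ} (H : RotApprox τ q p) (x y : ℝ) :
    ‖orbitVertex Φ x q - orbitVertex Φ y q‖ ≤ 12 * (2 * Real.pi) := by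
  refine DegreeControl.norm_birkhoff_sub_le (v := fun x => 2 * Real.pi * x) ⟨?_, ?_⟩ hΦ H
    unitExp_add_one ?_ x y
  · exact fun a b hab => mul_le_mul_of_nonneg_left hab Real.two_pi_pos.le
  · intro x; ring
  · intro x y
    rw [← mul_sub, abs_mul, abs_of_pos Real.two_pi_pos]
    exact norm_unitExp_sub_le x y

end Vertex

/-! ### Variation functions of periodic functions -/

section Variation

lemma eVariationOn_Icc_add_int {f : ℝ → ℝ} (hper : ∀ x, f (x + 1) = f x) (n : ℤ) (a b : ℝ) :
    eVariationOn f (Set.Icc (a + n) (b + n)) = eVariationOn f (Set.Icc a b) := by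
  have h1 := eVariationOn.comp_eq_of_monotoneOn f (t := Set.Icc a b) (fun x : ℝ => x + n)
    (fun x _ y _ hxy => by simpa using hxy)
  have h2 : f ∘ (fun x : ℝ => x + n) = f := by
    funext x
    have : Function.Periodic f 1 := hper
    simpa using this.int_mul n x
  rw [h2, Set.image_add_const_Icc] at h1
  exact h1.symm

lemma locallyBoundedVariationOn_of_periodic {f : ℝ → ℝ} (hper : ∀ x, f (x + 1) = f x)
    (hbv : BoundedVariationOn f (Set.Icc 0 1)) : LocallyBoundedVariationOn f Set.univ := by
  intro a b _ _
  rw [Set.univ_inter]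
  obtain ⟨N, hN⟩ := exists_nat_ge (max |a| |b|)
  have ha := abs_le.1 ((le_max_left _ _).trans hN)
  have hb := abs_le.1 ((le_max_right _ _).trans hN)
  have hsum := eVariationOn.sum' f (I := fun i : ℕ => (-N + i : ℝ))
    (fun i j hij => by simpa using hij) (n := 2 * N)
  have hbig : BoundedVariationOn f (Set.Icc (-N : ℝ) N) := by
    have e : Set.Icc (-N : ℝ) N = Set.Icc (-N + (0 : ℕ) : ℝ) (-N + (2 * N : ℕ)) := by
      push_cast; congr 1 <;> ring
    unfold BoundedVariationOn
    rw [e, ← hsum]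
    refine (ENNReal.sum_lt_top.2 fun i _ => ?_).ne
    have := eVariationOn_Icc_add_int hper (-N + i) 0 1
    push_cast at this ⊢
    rw [zero_add] at this
    rw [show (-N + (i + 1) : ℝ) = 1 + (-N + i) by ring, this]
    exact hbv.lt_top
  exact hbig.mono (Set.Icc_subset_Icc ha.1 hb.2)

/-- A periodic function of bounded variation is controlled by its variation function. -/
lemma exists_degreeControl {f : ℝ → ℝ} (hper : ∀ x, f (x + 1) = f x)
    (hbv : BoundedVariationOn f (Set.Icc 0 1)) :
    ∃ v V, DegreeControl v V ∧ ∀ x y, |f x - f y| ≤ |v x - v y| := by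
  have hl := locallyBoundedVariationOn_of_periodic hper hbv
  have hmono : Monotone (variationOnFromTo f Set.univ 0) := by
    rw [← monotoneOn_univ]
    exact variationOnFromTo.monotoneOn hl (Set.mem_univ 0)
  refine ⟨variationOnFromTo f Set.univ 0, variationOnFromTo f Set.univ 0 1, ⟨hmono, ?_⟩, ?_⟩
  · intro x
    have h1 := variationOnFromTo.add hl (Set.mem_univ 0) (Set.mem_univ 1) (Set.mem_univ (x + 1))
    have h2 := variationOnFromTo.comp_eq_of_monotoneOn f (t := Set.univ) (fun x : ℝ => x + 1)
      (fun x _ y _ hxy => by simpa using hxy) (x := 0) (y := x) (Set.mem_univ _) (Set.mem_univ _)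
    have h3 : f ∘ (fun x : ℝ => x + 1) = f := funext hper
    have h4 : (fun x : ℝ => x + 1) '' Set.univ = Set.univ :=
      Set.image_univ_of_surjective fun y => ⟨y - 1, by simp⟩
    rw [h3, h4] at h2
    simp only [zero_add] at h2
    rw [← h1, h2, add_comm]
  · have key : ∀ x y, x ≤ y → |f x - f y| ≤
        |variationOnFromTo f Set.univ 0 x - variationOnFromTo f Set.univ 0 y| := by
      intro x y hxy
      have := variationOnFromTo.abs_sub_le_sub_of_le hl (Set.mem_univ 0) (Set.mem_univ x)
        (Set.mem_univ y) hxy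
      rw [abs_sub_comm, abs_sub_comm (variationOnFromTo f Set.univ 0 x)]
      exact this.trans (le_abs_self _)
    intro x y
    rcases le_total x y with h | h
    · exact key x y h
    · rw [abs_sub_comm, abs_sub_comm (variationOnFromTo f Set.univ 0 x)]
      exact key y x h

end Variation

/-! ### Denjoy's inequality -/

section Derivative

variable {Φ h : CircleDeg1Lift} {τ : ℝ}

/-- The derivative of `Φ^n`, written as the product given by the chain rule. -/
noncomputable def derivIter (Φ : CircleDeg1Lift) (n : ℕ) (x : ℝ) : ℝ :=
  ∏ k ∈ range n, deriv Φ (Φ^[k] x)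

lemma IsC1BVDiffeo.hasDerivAt (hd : IsC1BVDiffeo Φ) (x : ℝ) : HasDerivAt Φ (deriv Φ x) x :=
  (hd.contDiff.differentiable one_ne_zero x).hasDerivAt

lemma IsC1BVDiffeo.hasDerivAt_iterate (hd : IsC1BVDiffeo Φ) (n : ℕ) (x : ℝ) :
    HasDerivAt (Φ^[n]) (derivIter Φ n x) x := by
  induction n with
  | zero => simpa [derivIter] using hasDerivAt_id x
  | succ n ih =>
    rw [Function.iterate_succ', derivIter, Finset.prod_range_succ, mul_comm]
    exact (hd.hasDerivAt _).comp x ih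

lemma IsC1BVDiffeo.derivIter_pos (hd : IsC1BVDiffeo Φ) (n : ℕ) (x : ℝ) : 0 < derivIter Φ n x :=
  Finset.prod_pos fun _ _ => hd.deriv_pos _

lemma IsC1BVDiffeo.log_derivIter (hd : IsC1BVDiffeo Φ) (n : ℕ) (x : ℝ) :
    Real.log (derivIter Φ n x) = ∑ k ∈ range n, Real.log (deriv Φ (Φ^[k] x)) :=
  Real.log_prod fun _ _ => (hd.deriv_pos _).ne'

lemma deriv_add_one (Φ : CircleDeg1Lift) (x : ℝ) : deriv Φ (x + 1) = deriv Φ x := by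
  rw [← deriv_comp_add_const Φ 1 x]
  have : (fun y => Φ (y + 1)) = fun y => Φ y + 1 := funext fun y => Φ.map_add_one y
  rw [this, deriv_add_const]

lemma IsC1BVDiffeo.continuous_deriv (hd : IsC1BVDiffeo Φ) : Continuous (deriv Φ) :=
  hd.contDiff.continuous_deriv le_rfl

lemma IsC1BVDiffeo.exists_degreeControl_log (hd : IsC1BVDiffeo Φ) :
    ∃ v V, DegreeControl v V ∧
      ∀ x y, |Real.log (deriv Φ x) - Real.log (deriv Φ y)| ≤ |v x - v y| := by
  obtain ⟨x₀, -, hx₀⟩ := (isCompact_Icc (a := (0 : ℝ)) (b := 1)).exists_isMinOn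
    ⟨0, by simp⟩ hd.continuous_deriv.continuousOn
  have hm := hd.deriv_pos x₀
  have hlip : LipschitzOnWith (Real.toNNReal (1 / deriv Φ x₀)) Real.log (Set.Ici (deriv Φ x₀)) := by
    refine LipschitzOnWith.of_dist_le_mul fun a ha b hb => ?_
    rw [Real.coe_toNNReal _ (by positivity), Real.dist_eq, Real.dist_eq]
    have key : ∀ a b, deriv Φ x₀ ≤ a → deriv Φ x₀ ≤ b →
        Real.log a - Real.log b ≤ 1 / deriv Φ x₀ * |a - b| := by
      intro a b ha hb
      have ha' := hm.trans_le ha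
      have hb' := hm.trans_le hb
      rw [← Real.log_div ha'.ne' hb'.ne']
      calc Real.log (a / b) ≤ a / b - 1 := Real.log_le_sub_one_of_pos (by positivity)
        _ = 1 / b * (a - b) := by field_simp
        _ ≤ 1 / b * |a - b| := by gcongr; exact le_abs_self _
        _ ≤ _ := by gcongr
    rw [abs_le]
    constructor
    · have := key b a hb ha
      rw [abs_sub_comm] at this
      linarith
    · exact key a b ha hb
  refine exists_degreeControl (f := fun x => Real.log (deriv Φ x)) (fun x => ?_) ?_
  · simp only [deriv_add_one]
  · exact hlip.comp_boundedVariationOn (fun x hx => hx₀ hx) hd.boundedVariation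

lemma IsC1BVDiffeo.exists_derivIter_mul (hd : IsC1BVDiffeo Φ) (n : ℕ) {a b : ℝ} (hab : a < b) :
    ∃ s ∈ Set.Ioo a b, derivIter Φ n s * (b - a) = Φ^[n] b - Φ^[n] a := by
  obtain ⟨s, hs, he⟩ := exists_hasDerivAt_eq_slope (Φ^[n]) (derivIter Φ n) hab
    (fun x _ => (hd.hasDerivAt_iterate n x).continuousAt.continuousWithinAt)
    (fun x _ => hd.hasDerivAt_iterate n x)
  refine ⟨s, hs, ?_⟩
  rw [he, div_mul_cancel₀ _ (sub_pos.2 hab).ne']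

/-- **Denjoy's inequality**: the Denjoy–Koksma inequality for `log Φ'`, compared with a point where
the derivative of `Φ^q` is `1`. -/
lemma IsC1BVDiffeo.exists_abs_log_derivIter_le (hd : IsC1BVDiffeo Φ)
    (hΦ : ∀ s, Φ (h s) = h (s + τ)) :
    ∃ C : ℝ, ∀ (q : ℕ) (p : ℤ), RotApprox τ q p → ∀ x, |Real.log (derivIter Φ q x)| ≤ C := by
  obtain ⟨v, V, hv, hf⟩ := hd.exists_degreeControl_log
  refine ⟨12 * V, fun q p H x => ?_⟩
  obtain ⟨y, -, hy⟩ := hd.exists_derivIter_mul q (zero_lt_one (α := ℝ))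
  have h1 := iterate_add_one Φ q 0
  rw [zero_add] at h1
  rw [h1, sub_zero, mul_one, add_sub_cancel_left] at hy
  have := hv.norm_birkhoff_sub_le hΦ H (f := fun x => Real.log (deriv Φ x))
    (fun x => by simp only [deriv_add_one]) hf x y
  rwa [← hd.log_derivIter, ← hd.log_derivIter, hy, Real.log_one, sub_zero] at this

end Derivative

/-! ### Denjoy's theorem: the semiconjugacy is a homeomorphism -/

section Conjugacy

variable {Φ h : CircleDeg1Lift} {τ : ℝ} {q : ℕ → ℕ} {p : ℕ → ℤ}

/-- There are no wandering intervals. For two points at the same angle the lengths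
`|Φ^k a - Φ^k b|` are summable, whereas Denjoy's inequality keeps them away from `0` along the
times `q n`. -/
lemma IsC1BVDiffeo.atAngle_unique (hd : IsC1BVDiffeo Φ) (hΦ : ∀ s, Φ (h s) = h (s + τ))
    (H : ∀ n, RotApprox τ (q n) (p n)) (hq : Tendsto q atTop atTop) {θ a b : ℝ}
    (ha : AtAngle h θ a) (hb : AtAngle h θ b) : a = b := by
  wlog hab : a < b generalizing a b
  · rcases (not_lt.1 hab).eq_or_lt with h | h
    · exact h.symm
    · exact (this hb ha h).symm
  exfalso
  obtain ⟨C, hC⟩ := hd.exists_abs_log_derivIter_le hΦ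
  have hid : DegreeControl (fun x => x) 1 := ⟨monotone_id, fun _ => rfl⟩
  have hsum : Summable fun k : ℕ => |Φ^[k] a - Φ^[k] b| := by
    refine summable_of_sum_range_le (c := 6) (fun _ => abs_nonneg _) fun N => ?_
    obtain ⟨n, hn⟩ := (hq.eventually_ge_atTop N).exists
    have := hid.sum_abs_sub_le hΦ (H n) ha hb (r := 0) (by simp)
    norm_num at this
    exact (Finset.sum_le_sum_of_subset_of_nonneg (Finset.range_mono hn)
      fun _ _ _ => abs_nonneg _).trans this
  have hlim := hsum.tendsto_atTop_zero.comp hq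
  have hlow : ∀ n, Real.exp (-C) * (b - a) ≤ |Φ^[q n] a - Φ^[q n] b| := by
    intro n
    obtain ⟨s, -, hs⟩ := hd.exists_derivIter_mul (q n) hab
    rw [abs_sub_comm, ← hs]
    refine le_trans ?_ (le_abs_self _)
    have hba := sub_pos.2 hab
    gcongr
    rw [← Real.le_log_iff_exp_le (hd.derivIter_pos _ _)]
    exact (abs_le.1 (hC _ _ (H n) s)).1
  have := ge_of_tendsto' hlim hlow
  have : 0 < Real.exp (-C) * (b - a) := mul_pos (Real.exp_pos _) (sub_pos.2 hab)
  linarith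

lemma IsC1BVDiffeo.continuous_conj (hd : IsC1BVDiffeo Φ) (hΦ : ∀ s, Φ (h s) = h (s + τ))
    (H : ∀ n, RotApprox τ (q n) (p n)) (hq : Tendsto q atTop atTop) : Continuous h := by
  rw [CircleDeg1Lift.continuous_iff_surjective]
  intro x
  obtain ⟨θ, hθ⟩ := exists_atAngle h x
  exact ⟨θ, hd.atAngle_unique hΦ H hq (atAngle_apply h θ) hθ⟩

/-- If `h` is constant on an interval, then at a time `q n` at which the rotation moves points by
less than its length, some `h u` returns to itself modulo `1`, so that the rotation number is
rational. -/
lemma strictMono_conj (hτ : Irrational τ) (hΦ : ∀ s, Φ (h s) = h (s + τ))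
    (hτΦ : Φ.translationNumber = τ)
    (H : ∀ n, RotApprox τ (q n) (p n)) (hq : Tendsto q atTop atTop) : StrictMono h := by
  intro s t hst
  refine (h.monotone hst.le).lt_of_ne fun heq => ?_
  have hconst : ∀ u, s ≤ u → u ≤ t → h u = h s := fun u h1 h2 =>
    le_antisymm ((h.monotone h2).trans_eq heq.symm) (h.monotone h1)
  -- a return time `q` for which the rotation moves points by less than `t - s`
  have hlim : Tendsto (fun n => 1 / (q n : ℝ)) atTop (𝓝 0) :=
    tendsto_one_div_atTop_nhds_zero_nat.comp hq
  obtain ⟨n, hn⟩ := (hlim.eventually_lt_const (sub_pos.2 hst)).exists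
  have hb := abs_le.1 ((H n).abs_mul_sub_le.trans hn.le)
  have hret : ∃ u, h (u + (q n * τ - p n)) = h u := by
    rcases le_total 0 (q n * τ - p n) with h0 | h0
    · exact ⟨s, hconst _ (by linarith) (by linarith)⟩
    · exact ⟨t, by rw [hconst _ (by linarith) (by linarith), hconst t hst.le le_rfl]⟩
  obtain ⟨u, hu⟩ := hret
  have h1 : (Φ ^ q n) (h u) = h u + p n := by
    rw [CircleDeg1Lift.coe_pow, iterate_semiconj hΦ, ← hu, ← CircleDeg1Lift.map_add_int]
    ring_nf
  have h2 := Φ.translationNumber_of_map_pow_eq_add_int h1 (H n).pos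
  rw [hτΦ] at h2
  exact hτ ⟨(p n : ℚ) / q n, by rw [h2]; push_cast; rfl⟩

lemma map_add_int_of_map_add_one {G : ℝ → ℝ} {γ : ℝ} (h1 : ∀ x, G (x + 1) = G x + γ) (x : ℝ)
    (n : ℤ) : G (x + n) = G x + γ * n := by
  have hper : Function.Periodic (fun x => G x - γ * x) 1 := fun x => by
    simp only [h1]; ring
  have := hper.int_mul n x
  simp only [mul_one] at this
  linarith

lemma uniformContinuous_of_map_add_one {G : ℝ → ℝ} {γ : ℝ} (hG : Continuous G)
    (h1 : ∀ x, G (x + 1) = G x + γ) : UniformContinuous G := by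
  have hcomp := isCompact_Icc (a := (-1 : ℝ)) (b := 2) |>.uniformContinuousOn_of_continuous
    hG.continuousOn
  rw [Metric.uniformContinuousOn_iff] at hcomp
  rw [Metric.uniformContinuous_iff]
  intro ε hε
  obtain ⟨δ, hδ, hcl⟩ := hcomp ε hε
  refine ⟨min δ 1, lt_min hδ one_pos, fun {x y} hxy => ?_⟩
  have hlt := lt_min_iff.1 hxy
  have h2 := abs_lt.1 (by simpa [Real.dist_eq] using hlt.2)
  have hx0 := Int.floor_le x
  have hx1 := Int.lt_floor_add_one x
  have := hcl (x + (-⌊x⌋ : ℤ)) ⟨by push_cast; linarith, by push_cast; linarith⟩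
    (y + (-⌊x⌋ : ℤ)) ⟨by push_cast; linarith, by push_cast; linarith⟩ (by simpa using hlt.1)
  rw [map_add_int_of_map_add_one h1, map_add_int_of_map_add_one h1] at this
  simpa using this

end Conjugacy

/-! ### The action on densities and its coboundaries -/

section Transfer

variable {Φ : CircleDeg1Lift}

/-- The densities on the circle: `1`-periodic, locally integrable functions on the line. These are
functions, not classes modulo null sets, so that pointwise bounds make sense. -/
structure PeriodicIntegrable (ψ : ℝ → ℝ) : Prop where
  add_one : ∀ x, ψ (x + 1) = ψ x
  intervalIntegrable : ∀ a b, IntervalIntegrable ψ volume a b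

namespace PeriodicIntegrable

variable {ψ χ : ℝ → ℝ}

lemma zero : PeriodicIntegrable 0 :=
  ⟨fun _ => rfl, fun _ _ => intervalIntegrable_const (c := (0 : ℝ))⟩

lemma add (hψ : PeriodicIntegrable ψ) (hχ : PeriodicIntegrable χ) : PeriodicIntegrable (ψ + χ) :=
  ⟨fun x => by simp [hψ.add_one, hχ.add_one],
    fun a b => (hψ.intervalIntegrable a b).add (hχ.intervalIntegrable a b)⟩

lemma smul (c : ℝ) (hψ : PeriodicIntegrable ψ) : PeriodicIntegrable (c • ψ) :=
  ⟨fun x => by simp [hψ.add_one], fun a b => (hψ.intervalIntegrable a b).smul c⟩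

lemma sub (hψ : PeriodicIntegrable ψ) (hχ : PeriodicIntegrable χ) : PeriodicIntegrable (ψ - χ) :=
  ⟨fun x => by simp [hψ.add_one, hχ.add_one],
    fun a b => (hψ.intervalIntegrable a b).sub (hχ.intervalIntegrable a b)⟩

lemma sum {ι : Type*} (s : Finset ι) {f : ι → ℝ → ℝ} (hf : ∀ i ∈ s, PeriodicIntegrable (f i)) :
    PeriodicIntegrable (∑ i ∈ s, f i) :=
  Finset.sum_induction f PeriodicIntegrable (fun _ _ => add) zero hf

lemma abs (hψ : PeriodicIntegrable ψ) : PeriodicIntegrable (fun x => |ψ x|) :=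
  ⟨fun x => by simp [hψ.add_one], fun a b => (hψ.intervalIntegrable a b).abs⟩

lemma integral_add_one_eq (hψ : PeriodicIntegrable ψ) (a b : ℝ) :
    ∫ x in a..a + 1, ψ x = ∫ x in b..b + 1, ψ x :=
  Function.Periodic.intervalIntegral_add_eq (fun x => hψ.add_one x) a b

end PeriodicIntegrable

/-- The action of `Φ` on densities, `ψ ↦ (ψ ∘ Φ) Φ'`; on primitives it is composition with `Φ`. -/
noncomputable def transfer (Φ : CircleDeg1Lift) (ψ : ℝ → ℝ) (x : ℝ) : ℝ := ψ (Φ x) * deriv Φ x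

lemma IsC1BVDiffeo.strictMono (hd : IsC1BVDiffeo Φ) : StrictMono Φ :=
  strictMono_of_deriv_pos hd.deriv_pos

lemma IsC1BVDiffeo.image_Ioc (hd : IsC1BVDiffeo Φ) (a b : ℝ) :
    Φ '' Set.Ioc a b = Set.Ioc (Φ a) (Φ b) :=
  (hd.strictMono.orderIsoOfSurjective Φ
    (Φ.continuous_iff_surjective.1 hd.contDiff.continuous)).image_Ioc a b

lemma IsC1BVDiffeo.integrableOn_transfer (hd : IsC1BVDiffeo Φ) {ψ : ℝ → ℝ}
    (hψ : PeriodicIntegrable ψ) {a b : ℝ} (hab : a ≤ b) :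
    IntegrableOn (transfer Φ ψ) (Set.Ioc a b) := by
  have h := (integrableOn_image_iff_integrableOn_abs_deriv_smul (measurableSet_Ioc (a := a) (b := b))
    (fun x _ => (hd.hasDerivAt x).hasDerivWithinAt) hd.strictMono.injective.injOn ψ).1 (by
      rw [hd.image_Ioc, ← intervalIntegrable_iff_integrableOn_Ioc_of_le (Φ.monotone hab)]
      exact hψ.intervalIntegrable _ _)
  refine h.congr_fun (fun x _ => ?_) measurableSet_Ioc
  simp only [transfer, smul_eq_mul, abs_of_pos (hd.deriv_pos x), mul_comm]

lemma IsC1BVDiffeo.periodicIntegrable_transfer (hd : IsC1BVDiffeo Φ) {ψ : ℝ → ℝ}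
    (hψ : PeriodicIntegrable ψ) : PeriodicIntegrable (transfer Φ ψ) where
  add_one x := by simp [transfer, hψ.add_one, deriv_add_one]
  intervalIntegrable a b := ⟨by
    rcases le_total a b with h | h
    · exact hd.integrableOn_transfer hψ h
    · simp [Set.Ioc_eq_empty_of_le h], by
    rcases le_total b a with h | h
    · exact hd.integrableOn_transfer hψ h
    · simp [Set.Ioc_eq_empty_of_le h]⟩

lemma IsC1BVDiffeo.integral_transfer (hd : IsC1BVDiffeo Φ) (ψ : ℝ → ℝ) (a b : ℝ) :
    ∫ x in a..b, transfer Φ ψ x = ∫ x in Φ a..Φ b, ψ x := by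
  wlog hab : a ≤ b generalizing a b
  · rw [intervalIntegral.integral_symm, intervalIntegral.integral_symm (Φ b),
      this b a (le_of_not_ge hab)]
  rw [intervalIntegral.integral_of_le hab, intervalIntegral.integral_of_le (Φ.monotone hab),
    ← hd.image_Ioc, integral_image_eq_integral_abs_deriv_smul measurableSet_Ioc
      (fun x _ => (hd.hasDerivAt x).hasDerivWithinAt) hd.strictMono.injective.injOn]
  refine setIntegral_congr_fun measurableSet_Ioc fun x _ => ?_
  simp only [transfer, smul_eq_mul, abs_of_pos (hd.deriv_pos x), mul_comm]

lemma IsC1BVDiffeo.integral_transfer_add_one (hd : IsC1BVDiffeo Φ) {ψ : ℝ → ℝ}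
    (hψ : PeriodicIntegrable ψ) (a : ℝ) :
    ∫ x in a..a + 1, transfer Φ ψ x = ∫ x in a..a + 1, ψ x := by
  rw [hd.integral_transfer, Φ.map_add_one, hψ.integral_add_one_eq]

lemma transfer_iterate (Φ : CircleDeg1Lift) (ψ : ℝ → ℝ) (k : ℕ) (x : ℝ) :
    (transfer Φ)^[k] ψ x = ψ (Φ^[k] x) * derivIter Φ k x := by
  induction k generalizing x with
  | zero => simp [derivIter]
  | succ k ih =>
    rw [Function.iterate_succ_apply', transfer, ih, derivIter, derivIter,
      Finset.prod_range_succ', mul_assoc]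
    rfl

lemma IsC1BVDiffeo.periodicIntegrable_transfer_iterate (hd : IsC1BVDiffeo Φ) {ψ : ℝ → ℝ}
    (hψ : PeriodicIntegrable ψ) (k : ℕ) : PeriodicIntegrable ((transfer Φ)^[k] ψ) := by
  induction k with
  | zero => exact hψ
  | succ k ih => rw [Function.iterate_succ_apply']; exact hd.periodicIntegrable_transfer ih

/-- Coboundaries of the action of `Φ` on densities. -/
def IsCoboundary (Φ : CircleDeg1Lift) (u : ℝ → ℝ) : Prop :=
  ∃ g, PeriodicIntegrable g ∧ u = transfer Φ g - g

namespace IsCoboundary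

variable {u u' : ℝ → ℝ}

lemma zero : IsCoboundary Φ 0 := ⟨0, .zero, by ext x; simp [transfer]⟩

lemma add (h : IsCoboundary Φ u) (h' : IsCoboundary Φ u') : IsCoboundary Φ (u + u') := by
  obtain ⟨g, hg, rfl⟩ := h
  obtain ⟨g', hg', rfl⟩ := h'
  exact ⟨g + g', hg.add hg', by ext x; simp [transfer]; ring⟩

lemma smul (c : ℝ) (h : IsCoboundary Φ u) : IsCoboundary Φ (c • u) := by
  obtain ⟨g, hg, rfl⟩ := h
  exact ⟨c • g, hg.smul c, by ext x; simp [transfer]; ring⟩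

lemma sum {ι : Type*} (s : Finset ι) {f : ι → ℝ → ℝ} (hf : ∀ i ∈ s, IsCoboundary Φ (f i)) :
    IsCoboundary Φ (∑ i ∈ s, f i) :=
  Finset.sum_induction f (IsCoboundary Φ) (fun _ _ => add) zero hf

lemma transfer_iterate_sub (hd : IsC1BVDiffeo Φ) {ψ : ℝ → ℝ} (hψ : PeriodicIntegrable ψ) (k : ℕ) :
    IsCoboundary Φ ((transfer Φ)^[k] ψ - ψ) := by
  induction k with
  | zero => simpa using zero
  | succ k ih =>
    have h1 : IsCoboundary Φ ((transfer Φ)^[k + 1] ψ - (transfer Φ)^[k] ψ) :=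
      ⟨(transfer Φ)^[k] ψ, hd.periodicIntegrable_transfer_iterate hψ k, by
        rw [Function.iterate_succ_apply']⟩
    simpa using h1.add ih

lemma periodicIntegrable (hd : IsC1BVDiffeo Φ) (h : IsCoboundary Φ u) : PeriodicIntegrable u := by
  obtain ⟨g, hg, rfl⟩ := h
  exact (hd.periodicIntegrable_transfer hg).sub hg

lemma integral_eq_zero (hd : IsC1BVDiffeo Φ) (h : IsCoboundary Φ u) (a : ℝ) :
    ∫ x in a..a + 1, u x = 0 := by
  obtain ⟨g, hg, rfl⟩ := h
  simp only [Pi.sub_apply]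
  rw [intervalIntegral.integral_sub
    ((hd.periodicIntegrable_transfer hg).intervalIntegrable _ _) (hg.intervalIntegrable _ _),
    hd.integral_transfer_add_one hg, sub_self]

end IsCoboundary

end Transfer

/-! ### Averages of translates of an arc -/

section Doeblin

variable {Φ h : CircleDeg1Lift} {τ : ℝ}

/-- Among the first `q` iterates of a rotation by `τ`, one moves `θ` into any given arc of length
`3 / q`. -/
lemma RotApprox.exists_return {q : ℕ} {p : ℤ} (H : RotApprox τ q p) (θ α : ℝ) :
    ∃ k < q, ∃ n : ℤ, α ≤ θ + k * τ + n ∧ θ + k * τ + n < α + 3 / q := by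
  have hq : (0 : ℝ) < q := by exact_mod_cast H.pos
  have hqz : (0 : ℤ) < q := by exact_mod_cast H.pos
  obtain ⟨a, b, hab⟩ := H.coprime
  set j : ℤ := ⌈(α - θ) * q⌉ + 1 with hj
  have hj1 : (α - θ) * q + 1 ≤ j := by
    rw [hj]; push_cast; linarith [Int.le_ceil ((α - θ) * q)]
  have hj2 : (j : ℝ) < (α - θ) * q + 2 := by
    rw [hj]; push_cast; linarith [Int.ceil_lt_add_one ((α - θ) * q)]
  have hk0 : (((j * a % q).toNat : ℕ) : ℤ) = j * a % q :=
    Int.toNat_of_nonneg (Int.emod_nonneg _ hqz.ne')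
  have hkq : (j * a % q).toNat < q := by
    have := Int.emod_lt_of_pos (j * a) hqz
    omega
  set k : ℕ := (j * a % q).toNat
  have hmod := Int.emod_add_mul_ediv (j * a) q
  refine ⟨k, hkq, j * a / q * p + j * b, ?_⟩
  have hjz : j = k * p + (j * a / q * p + j * b) * q := by
    rw [hk0]
    linear_combination (-j) * hab - p * hmod
  have hjr : (j : ℝ) = k * p + ((j * a / q * p + j * b : ℤ) : ℝ) * q := by exact_mod_cast hjz
  set n : ℤ := j * a / q * p + j * b
  have hb := abs_le.1 (H.abs_mul_le hkq.le)
  have e : (θ + k * τ + n) * q = θ * q + j + (k * τ - k * p / q) * q := by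
    rw [hjr]; field_simp; ring
  have b1 : (k * τ - k * p / q) * q ≤ 1 := by
    have := mul_le_mul_of_nonneg_right hb.2 hq.le
    rwa [div_mul_cancel₀ _ hq.ne'] at this
  have b2 : -1 ≤ (k * τ - k * p / q) * q := by
    have := mul_le_mul_of_nonneg_right hb.1 hq.le
    rwa [neg_mul, div_mul_cancel₀ _ hq.ne'] at this
  constructor
  · refine le_of_mul_le_mul_right ?_ hq
    rw [e]; linarith
  · refine lt_of_mul_lt_mul_right ?_ hq.le
    rw [e, add_mul α, div_mul_cancel₀ _ hq.ne']; linarith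

lemma derivIter_add_int (Φ : CircleDeg1Lift) (k : ℕ) (x : ℝ) (n : ℤ) :
    derivIter Φ k (x + n) = derivIter Φ k x := by
  refine Finset.prod_congr rfl fun j _ => ?_
  have hper : Function.Periodic (deriv Φ) 1 := deriv_add_one Φ
  rw [iterate_add_int]
  simpa using hper.int_mul n (Φ^[j] x)

/-- Bounded distortion: the derivatives of `Φ^k`, `k ≤ q`, at points with angles `O(1 / q)` apart are
comparable. -/
lemma IsC1BVDiffeo.exists_distortion (hd : IsC1BVDiffeo Φ) (hΦ : ∀ s, Φ (h s) = h (s + τ)) (r : ℕ) :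
    ∃ C : ℝ, 0 ≤ C ∧ ∀ (q : ℕ) (p : ℤ), RotApprox τ q p → ∀ θ θ' : ℝ, |θ - θ'| ≤ r / q →
      ∀ k ≤ q, Real.exp (-C) * derivIter Φ k (h θ) ≤ derivIter Φ k (h θ') := by
  obtain ⟨v, V, hv, hf⟩ := hd.exists_degreeControl_log
  have hV : 0 ≤ V := by
    have h1 := hv.map_add_one 0
    have h2 := hv.mono (show (0 : ℝ) ≤ 0 + 1 by norm_num)
    linarith
  refine ⟨2 * (r + 3) * V, by positivity, fun q p H θ θ' hθ k hk => ?_⟩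
  have hsum := hv.sum_abs_sub_le hΦ H (atAngle_apply h θ) (atAngle_apply h θ') hθ
  have hle : Real.log (derivIter Φ k (h θ)) - Real.log (derivIter Φ k (h θ'))
      ≤ 2 * (r + 3) * V := by
    rw [hd.log_derivIter, hd.log_derivIter, ← Finset.sum_sub_distrib]
    refine le_trans ?_ hsum
    refine (Finset.sum_le_sum fun j _ => (le_abs_self _).trans (hf _ _)).trans ?_
    exact Finset.sum_le_sum_of_subset_of_nonneg (Finset.range_mono hk) fun _ _ _ => abs_nonneg _
  have h1 := hd.derivIter_pos k (h θ)
  have h2 := hd.derivIter_pos k (h θ')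
  calc Real.exp (-(2 * (r + 3) * V)) * derivIter Φ k (h θ)
      = Real.exp (-(2 * (r + 3) * V) + Real.log (derivIter Φ k (h θ))) := by
        rw [Real.exp_add, Real.exp_log h1]
    _ ≤ Real.exp (Real.log (derivIter Φ k (h θ'))) := Real.exp_le_exp.2 (by linarith)
    _ = _ := Real.exp_log h2

/-- A Doeblin minorization. Let `I` be an arc of angular width between `3 / q` and `6 / q`. The
`q` preimages `J k` of `I` under `Φ^k` cover the circle with bounded multiplicity, and by bounded
distortion `Φ^k` has derivative about `|I| / |J k|` on `J k`. Hence the average of the translates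
of the indicator of `I` with weights proportional to `|J k|` is at least `δ |I|` everywhere, with
a `δ` that depends on `Φ` alone. -/
lemma IsC1BVDiffeo.exists_minorization (hd : IsC1BVDiffeo Φ) (hΦ : ∀ s, Φ (h s) = h (s + τ))
    (hcont : Continuous h) (hmono : StrictMono h) :
    ∃ δ : ℝ, 0 < δ ∧ δ ≤ 1 ∧ ∀ (q : ℕ) (p : ℤ), RotApprox τ q p → ∀ α l : ℝ,
      3 / (q : ℝ) ≤ l → l ≤ 6 / q →
      ∃ w : ℕ → ℝ, (∀ k, 0 ≤ w k) ∧ ∑ k ∈ range q, w k = 1 ∧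
        ∀ t, ∃ k < q, ∃ n : ℤ, Φ^[k] t + n ∈ Set.Ico (h α) (h (α + l)) ∧
          δ * (h (α + l) - h α) ≤ w k * derivIter Φ k t := by
  obtain ⟨C, hC0, hC⟩ := hd.exists_distortion hΦ 6
  have hsurj := h.continuous_iff_surjective.1 hcont
  refine ⟨Real.exp (-C) / 18, by positivity, ?_, fun q p H α l hl3 hl6 => ?_⟩
  · have : Real.exp (-C) ≤ 1 := Real.exp_le_one_iff.2 (by linarith)
    linarith
  have hq : (0 : ℝ) < q := by exact_mod_cast H.pos
  have hl : 0 < l := lt_of_lt_of_le (by positivity) hl3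
  set L : ℕ → ℝ := fun k => h (α + l - k * τ) - h (α - k * τ) with hLdef
  have hL : ∀ k, 0 < L k := fun k => sub_pos.2 (hmono (by linarith))
  set S := ∑ k ∈ range q, L k with hS
  have hS0 : 0 < S := Finset.sum_pos (fun k _ => hL k) (Finset.nonempty_range_iff.2 H.pos.ne')
  -- the preimages of `[h α, h (α + l))` are forward images of the last one of them
  have hS18 : S ≤ 18 := by
    have hid : DegreeControl (fun x => x) 1 := ⟨monotone_id, fun _ => rfl⟩
    have := hid.sum_abs_sub_le hΦ H (atAngle_apply h (α + l - (q - 1 : ℕ) * τ))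
      (atAngle_apply h (α - (q - 1 : ℕ) * τ)) (r := 6) (by
        rw [show α + l - (q - 1 : ℕ) * τ - (α - (q - 1 : ℕ) * τ) = l by ring, abs_of_pos hl]
        exact_mod_cast hl6)
    norm_num at this
    refine le_trans (le_of_eq ?_) this
    rw [hS, ← Finset.sum_range_reflect]
    refine Finset.sum_congr rfl fun k hk => ?_
    have hk' := Finset.mem_range.1 hk
    have e : ((q - 1 : ℕ) : ℝ) = ((q - 1 - k : ℕ) : ℝ) + k := by
      exact_mod_cast (show q - 1 = q - 1 - k + k by omega)
    rw [iterate_semiconj hΦ, iterate_semiconj hΦ, e,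
      show α + l - (((q - 1 - k : ℕ) : ℝ) + k) * τ + k * τ = α + l - ((q - 1 - k : ℕ) : ℝ) * τ by ring,
      show α - (((q - 1 - k : ℕ) : ℝ) + k) * τ + k * τ = α - ((q - 1 - k : ℕ) : ℝ) * τ by ring,
      abs_of_pos (hL (q - 1 - k))]
  refine ⟨fun k => L k / S, fun k => (div_pos (hL k) hS0).le, ?_, fun t => ?_⟩
  · rw [← Finset.sum_div, div_self hS0.ne']
  obtain ⟨θ, rfl⟩ := hsurj t
  obtain ⟨k, hk, n, hn1, hn2⟩ := H.exists_return θ α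
  refine ⟨k, hk, n, ?_, ?_⟩
  · rw [iterate_semiconj hΦ, ← CircleDeg1Lift.map_add_int]
    exact ⟨h.monotone hn1, hmono (by linarith)⟩
  · obtain ⟨s, hs, hse⟩ := hd.exists_derivIter_mul k (sub_pos.1 (hL k))
    rw [iterate_semiconj hΦ, iterate_semiconj hΦ, sub_add_cancel, sub_add_cancel] at hse
    obtain ⟨σ, rfl⟩ := hsurj s
    have hσ1 := hmono.lt_iff_lt.1 hs.1
    have hσ2 := hmono.lt_iff_lt.1 hs.2
    have hdist := hC q p H σ (θ + n) (by
      rw [abs_le]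
      push_cast
      constructor <;> linarith) k hk.le
    rw [CircleDeg1Lift.map_add_int, derivIter_add_int] at hdist
    have h0 : 0 < h (α + l) - h α := sub_pos.2 (hmono (by linarith))
    calc Real.exp (-C) / 18 * (h (α + l) - h α)
        ≤ Real.exp (-C) / S * (h (α + l) - h α) := by gcongr
      _ = L k / S * (Real.exp (-C) * derivIter Φ k (h σ)) := by rw [← hse]; ring
      _ ≤ L k / S * derivIter Φ k (h θ) :=
        mul_le_mul_of_nonneg_left hdist (div_pos (hL k) hS0).le

end Doeblin

/-! ### Periodic step functions -/

section Tiles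

/-- The `1`-periodic extension of the indicator of `[A, B) ⊆ [c, c + 1)`. -/
noncomputable def tileIndicator (c A B t : ℝ) : ℝ :=
  Set.indicator (Set.Ico A B) 1 (c + Int.fract (t - c))

lemma tileIndicator_nonneg (c A B t : ℝ) : 0 ≤ tileIndicator c A B t :=
  Set.indicator_nonneg (fun _ _ => zero_le_one) _

lemma periodicIntegrable_tileIndicator (c A B : ℝ) :
    PeriodicIntegrable (tileIndicator c A B) where
  add_one x := by
    rw [tileIndicator, tileIndicator, show x + 1 - c = x - c + 1 by ring, Int.fract_add_one]
  intervalIntegrable a b := by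
    have hm : Measurable (tileIndicator c A B) :=
      (measurable_one.indicator measurableSet_Ico).comp
        ((measurable_fract.comp (measurable_id.sub_const c)).const_add c)
    refine (intervalIntegrable_const (c := (1 : ℝ))).mono_fun hm.aestronglyMeasurable
      (Eventually.of_forall fun t => ?_)
    change ‖tileIndicator c A B t‖ ≤ ‖(1 : ℝ)‖
    rw [Real.norm_of_nonneg (tileIndicator_nonneg c A B t), norm_one]
    exact Set.indicator_le_self' (fun _ _ => zero_le_one) _

lemma tileIndicator_eq_one {c A B t : ℝ} (hA : c ≤ A) (hB : B ≤ c + 1) {n : ℤ}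
    (ht : t + n ∈ Set.Ico A B) : tileIndicator c A B t = 1 := by
  have h1 : Int.fract (t - c) = t + n - c := by
    rw [Int.fract_eq_iff]
    exact ⟨by linarith [ht.1], by linarith [ht.2], -n, by push_cast; ring⟩
  rw [tileIndicator, h1, add_sub_cancel, Set.indicator_of_mem ht, Pi.one_apply]

lemma tileIndicator_of_mem {c A B t : ℝ} (ht : t ∈ Set.Ico c (c + 1)) :
    tileIndicator c A B t = Set.indicator (Set.Ico A B) 1 t := by
  rw [tileIndicator, Int.fract_eq_self.2 ⟨by linarith [ht.1], by linarith [ht.2]⟩, add_sub_cancel]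

lemma integral_tileIndicator {c A B : ℝ} (hA : c ≤ A) (hAB : A ≤ B) (hB : B ≤ c + 1) :
    ∫ t in c..c + 1, tileIndicator c A B t = B - A := by
  rw [intervalIntegral.integral_of_le (by linarith), ← integral_Ico_eq_integral_Ioc,
    setIntegral_congr_fun measurableSet_Ico fun t ht => tileIndicator_of_mem ht,
    setIntegral_indicator measurableSet_Ico,
    Set.inter_eq_self_of_subset_right (Set.Ico_subset_Ico hA hB)]
  simp [hAB]

lemma exists_mem_Ico_of_monotone {a : ℕ → ℝ} {m : ℕ} {t : ℝ} (h0 : a 0 ≤ t) (hm : t < a m) :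
    ∃ i < m, t ∈ Set.Ico (a i) (a (i + 1)) := by
  induction m with
  | zero => exact absurd hm (not_lt.2 h0)
  | succ m ih =>
    rcases lt_or_ge t (a m) with h | h
    · obtain ⟨i, hi, hit⟩ := ih h
      exact ⟨i, by omega, hit⟩
    · exact ⟨m, by omega, h, hm⟩

/-- The `1`-periodic step function with value `y i` on `[a i, a (i + 1))` for `i < m`, where
`a 0 = c` and `a m = c + 1`. -/
noncomputable def stepFun (c : ℝ) (a : ℕ → ℝ) (m : ℕ) (y : ℕ → ℝ) : ℝ → ℝ :=
  ∑ i ∈ range m, y i • tileIndicator c (a i) (a (i + 1))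

lemma stepFun_apply (c : ℝ) (a : ℕ → ℝ) (m : ℕ) (y : ℕ → ℝ) (t : ℝ) :
    stepFun c a m y t = ∑ i ∈ range m, y i * tileIndicator c (a i) (a (i + 1)) t := by
  simp [stepFun]

lemma periodicIntegrable_stepFun (c : ℝ) (a : ℕ → ℝ) (m : ℕ) (y : ℕ → ℝ) :
    PeriodicIntegrable (stepFun c a m y) :=
  .sum _ fun _ _ => (periodicIntegrable_tileIndicator _ _ _).smul _

lemma integral_weighted_sum {m : ℕ} {f : ℕ → ℝ → ℝ} (hf : ∀ i, PeriodicIntegrable (f i)) (y : ℕ → ℝ)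
    (a b : ℝ) :
    ∫ t in a..b, ∑ i ∈ range m, y i * f i t = ∑ i ∈ range m, y i * ∫ t in a..b, f i t := by
  rw [intervalIntegral.integral_finsetSum fun i _ => ((hf i).intervalIntegrable a b).const_mul _]
  simp only [intervalIntegral.integral_const_mul]

variable {c : ℝ} {a : ℕ → ℝ} {m : ℕ}

lemma stepFun_of_mem (ha : Monotone a) (h0 : a 0 = c) (hm : a m = c + 1) (y : ℕ → ℝ) {t : ℝ}
    {i : ℕ} (hi : i < m) (ht : t ∈ Set.Ico (a i) (a (i + 1))) : stepFun c a m y t = y i := by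
  have htc : t ∈ Set.Ico c (c + 1) :=
    ⟨h0 ▸ (ha (Nat.zero_le i)).trans ht.1, ht.2.trans_le (hm ▸ ha hi)⟩
  rw [stepFun_apply, Finset.sum_eq_single i]
  · rw [tileIndicator_of_mem htc, Set.indicator_of_mem ht, Pi.one_apply, mul_one]
  · intro j _ hji
    rw [tileIndicator_of_mem htc, Set.indicator_of_notMem, mul_zero]
    intro htj
    rcases lt_or_gt_of_ne hji with h | h
    · exact absurd (htj.2.trans_le (ha h)) (not_lt.2 ht.1)
    · exact absurd (ht.2.trans_le (ha h)) (not_lt.2 htj.1)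
  · intro h
    exact absurd (Finset.mem_range.2 hi) h

lemma integral_stepFun (ha : Monotone a) (h0 : a 0 = c) (hm : a m = c + 1) (y : ℕ → ℝ) :
    ∫ t in c..c + 1, stepFun c a m y t = ∑ i ∈ range m, y i * (a (i + 1) - a i) := by
  simp only [stepFun_apply]
  rw [integral_weighted_sum fun i => periodicIntegrable_tileIndicator _ _ _]
  refine Finset.sum_congr rfl fun i hi => ?_
  rw [integral_tileIndicator (h0 ▸ ha (Nat.zero_le i)) (ha i.le_succ)
    (hm ▸ ha (Finset.mem_range.1 hi))]

lemma integral_abs_stepFun (ha : Monotone a) (h0 : a 0 = c) (hm : a m = c + 1) (y : ℕ → ℝ) :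
    ∫ t in c..c + 1, |stepFun c a m y t| = ∑ i ∈ range m, |y i| * (a (i + 1) - a i) := by
  rw [← integral_stepFun ha h0 hm, intervalIntegral.integral_of_le (by linarith),
    intervalIntegral.integral_of_le (by linarith), ← integral_Ico_eq_integral_Ioc,
    ← integral_Ico_eq_integral_Ioc]
  refine setIntegral_congr_fun measurableSet_Ico fun t ht => ?_
  obtain ⟨i, hi, hit⟩ := exists_mem_Ico_of_monotone (h0.symm ▸ ht.1) (hm.symm ▸ ht.2)
  simp only [stepFun_of_mem ha h0 hm _ hi hit]

/-- Step functions on any sufficiently fine partition approximate a given density in the mean. -/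
lemma PeriodicIntegrable.exists_step_approx {ψ : ℝ → ℝ} (hψ : PeriodicIntegrable ψ) (c : ℝ)
    {η : ℝ} (hη : 0 < η) :
    ∃ ρ > 0, ∀ (a : ℕ → ℝ) (m : ℕ), Monotone a → a 0 = c → a m = c + 1 →
      (∀ i < m, a (i + 1) - a i < ρ) →
      ∃ y : ℕ → ℝ, ∫ t in c..c + 1, |ψ t - stepFun c a m y t| ≤ η := by
  have hint : IntegrableOn ψ (Set.Ioc c (c + 1)) :=
    (intervalIntegrable_iff_integrableOn_Ioc_of_le (by linarith)).1 (hψ.intervalIntegrable _ _)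
  obtain ⟨g, -, hg, hgc, hgi⟩ := ((integrable_indicator_iff measurableSet_Ioc).2
    hint).exists_hasCompactSupport_integral_sub_le (half_pos hη)
  have hunif := (isCompact_Icc (a := c) (b := c + 1)).uniformContinuousOn_of_continuous
    hgc.continuousOn
  rw [Metric.uniformContinuousOn_iff] at hunif
  obtain ⟨ρ, hρ, hclose⟩ := hunif (η / 2) (half_pos hη)
  refine ⟨ρ, hρ, fun a m ha h0 hm hmesh => ⟨fun i => g (a i), ?_⟩⟩
  have hψg : ∫ t in c..c + 1, |ψ t - g t| ≤ η / 2 := by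
    rw [intervalIntegral.integral_of_le (by linarith)]
    calc ∫ t in Set.Ioc c (c + 1), |ψ t - g t|
        = ∫ t in Set.Ioc c (c + 1), ‖(Set.Ioc c (c + 1)).indicator ψ t - g t‖ :=
          setIntegral_congr_fun measurableSet_Ioc fun t ht => by
            simp only [Set.indicator_of_mem ht, Real.norm_eq_abs]
      _ ≤ ∫ t, ‖(Set.Ioc c (c + 1)).indicator ψ t - g t‖ :=
          setIntegral_le_integral
            (((integrable_indicator_iff measurableSet_Ioc).2 hint).sub hgi).norm
            (Eventually.of_forall fun _ => norm_nonneg _)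
      _ ≤ η / 2 := hg
  have hi1 : IntervalIntegrable (fun t => |ψ t - g t|) volume c (c + 1) :=
    ((hψ.intervalIntegrable _ _).sub (hgc.intervalIntegrable _ _)).abs
  have hi2 := (hψ.sub (periodicIntegrable_stepFun c a m fun i => g (a i))).abs.intervalIntegrable
    c (c + 1)
  calc ∫ t in c..c + 1, |ψ t - stepFun c a m (fun i => g (a i)) t|
      ≤ ∫ t in c..c + 1, (|ψ t - g t| + η / 2) := by
        refine intervalIntegral.integral_mono_on_of_le_Ioo (by linarith) hi2
          (hi1.add intervalIntegrable_const) fun t ht => ?_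
        obtain ⟨i, hi, hit⟩ := exists_mem_Ico_of_monotone (h0.symm ▸ ht.1.le) (hm.symm ▸ ht.2)
        rw [stepFun_of_mem ha h0 hm _ hi hit]
        have hai : a i ∈ Set.Icc c (c + 1) := ⟨h0 ▸ ha (Nat.zero_le i), hm ▸ ha hi.le⟩
        have := hclose t (Set.Ioo_subset_Icc_self ht) (a i) hai (by
          rw [Real.dist_eq, abs_of_nonneg (by linarith [hit.1])]
          linarith [hit.2, hmesh i hi])
        rw [Real.dist_eq] at this
        calc |ψ t - g (a i)| = |(ψ t - g t) + (g t - g (a i))| := by ring_nf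
          _ ≤ _ := (abs_add_le _ _).trans (by linarith)
    _ = (∫ t in c..c + 1, |ψ t - g t|) + η / 2 := by
        rw [intervalIntegral.integral_add hi1 intervalIntegrable_const]
        simp
    _ ≤ η := by linarith

end Tiles

/-! ### Density of coboundaries -/

section Contraction

variable {Φ h : CircleDeg1Lift} {τ : ℝ} {q : ℕ → ℕ} {p : ℕ → ℤ}

/-- A density of mean zero can be moved closer to `0` by a coboundary, by a factor that does not
depend on the density. Approximate it by a step function and replace each tile by the average of
its translates that the minorization provides, which changes the step function by a coboundary.
Each average is `δ |I|` plus a nonnegative function of integral `(1 - δ) |I|`, and the constants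
nearly cancel because the mean is zero. -/
lemma IsC1BVDiffeo.exists_coboundary_contraction (hd : IsC1BVDiffeo Φ)
    (hΦ : ∀ s, Φ (h s) = h (s + τ)) (hcont : Continuous h) (hmono : StrictMono h)
    (H : ∀ n, RotApprox τ (q n) (p n)) (hq : Tendsto q atTop atTop) :
    ∃ δ : ℝ, 0 < δ ∧ δ ≤ 1 ∧ ∀ ψ, PeriodicIntegrable ψ → ∫ t in (h 0)..(h 0) + 1, ψ t = 0 →
      ∀ η > 0, ∃ u, IsCoboundary Φ u ∧ ∫ t in (h 0)..(h 0) + 1, |ψ t - u t|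
        ≤ (1 - δ) * (∫ t in (h 0)..(h 0) + 1, |ψ t|) + η := by
  obtain ⟨δ, hδ0, hδ1, hδ⟩ := hd.exists_minorization hΦ hcont hmono
  refine ⟨δ, hδ0, hδ1, fun ψ hψ hψ0 η hη => ?_⟩
  set c := h 0 with hc
  obtain ⟨ρ, hρ, happ⟩ := hψ.exists_step_approx c (show 0 < η / 4 by positivity)
  obtain ⟨κ, hκ, hκh⟩ := Metric.uniformContinuous_iff.1
    (uniformContinuous_of_map_add_one hcont h.map_add_one) ρ hρ
  -- tiles of angular width `1 / m`, of the size of the mesh of the orbit of length `q n`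
  have hlim : Tendsto (fun n => 6 / (q n : ℝ)) atTop (𝓝 0) :=
    tendsto_const_div_atTop_nhds_zero_nat 6 |>.comp hq
  obtain ⟨n, hnκ, hn3⟩ := ((hlim.eventually_lt_const hκ).and (hq.eventually_ge_atTop 3)).exists
  set m := q n / 3 with hm
  have hm0 : 0 < m := by omega
  have hmR : (0 : ℝ) < m := by exact_mod_cast hm0
  have hqR : (0 : ℝ) < q n := by exact_mod_cast (H n).pos
  have hl3 : 3 / (q n : ℝ) ≤ 1 / m := by
    rw [div_le_div_iff₀ hqR hmR]
    exact_mod_cast (show 3 * m ≤ 1 * q n by omega)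
  have hl6 : 1 / (m : ℝ) ≤ 6 / q n := by
    rw [div_le_div_iff₀ hmR hqR]
    exact_mod_cast (show 1 * q n ≤ 6 * m by omega)
  set a : ℕ → ℝ := fun i => h (i / m) with ha
  have hamono : Monotone a := fun i j hij => h.monotone (by gcongr)
  have ha0 : a 0 = c := by simp [ha, hc]
  have ham : a m = c + 1 := by
    simp only [ha, hc]
    rw [div_self hmR.ne', ← CircleDeg1Lift.map_add_one, zero_add]
  have hasucc : ∀ i : ℕ, h (i / m + 1 / m) = a (i + 1) := fun i => by
    simp only [ha]; push_cast; rw [add_div]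
  have hac : ∀ i, c ≤ a i := fun i => ha0 ▸ hamono (Nat.zero_le i)
  have hac1 : ∀ i < m, a (i + 1) ≤ c + 1 := fun i hi => ham ▸ hamono hi
  obtain ⟨y, hy⟩ := happ a m hamono ha0 ham fun i _ => by
    rw [← hasucc]
    refine lt_of_le_of_lt (le_abs_self _) (hκh ?_)
    rw [Real.dist_eq, add_sub_cancel_left, abs_of_pos (by positivity)]
    linarith
  choose w hw0 hw1 hwt using fun i : ℕ => hδ (q n) (p n) (H n) (i / m) (1 / m) hl3 hl6
  set χ : ℕ → ℝ → ℝ := fun i => tileIndicator c (a i) (a (i + 1)) with hχ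
  have hχI : ∀ i, PeriodicIntegrable (χ i) := fun i => periodicIntegrable_tileIndicator _ _ _
  -- the averages of the translates of each tile
  set P : ℕ → ℝ → ℝ := fun i => ∑ k ∈ range (q n), w i k • (transfer Φ)^[k] (χ i) with hP
  have hPI : ∀ i, PeriodicIntegrable (P i) := fun i =>
    .sum _ fun k _ => (hd.periodicIntegrable_transfer_iterate (hχI i) k).smul _
  have hPcob : ∀ i, IsCoboundary Φ (P i - χ i) := fun i => by
    have : P i - χ i = ∑ k ∈ range (q n), w i k • ((transfer Φ)^[k] (χ i) - χ i) := by
      simp only [hP, smul_sub, Finset.sum_sub_distrib, ← Finset.sum_smul, hw1, one_smul]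
    rw [this]
    exact .sum _ fun k _ => (IsCoboundary.transfer_iterate_sub hd (hχI i) k).smul _
  have hPint : ∀ i < m, ∫ t in c..c + 1, P i t = a (i + 1) - a i := fun i hi => by
    rw [← integral_tileIndicator (hac i) (hamono i.le_succ) (hac1 i hi), ← sub_eq_zero,
      ← intervalIntegral.integral_sub ((hPI i).intervalIntegrable _ _)
        ((hχI i).intervalIntegrable _ _)]
    exact (hPcob i).integral_eq_zero hd c
  have hPlow : ∀ i < m, ∀ t, δ * (a (i + 1) - a i) ≤ P i t := fun i hi t => by
    obtain ⟨k, hk, j, hkj, hle⟩ := hwt i t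
    rw [hasucc] at hkj hle
    refine hle.trans ?_
    have hone : χ i (Φ^[k] t) = 1 := tileIndicator_eq_one (hac i) (hac1 i hi) hkj
    simp only [hP, Finset.sum_apply, Pi.smul_apply, smul_eq_mul, transfer_iterate]
    have := Finset.single_le_sum
      (f := fun k => w i k * (χ i (Φ^[k] t) * derivIter Φ k t)) (s := range (q n))
      (fun k _ => mul_nonneg (hw0 i k)
        (mul_nonneg (tileIndicator_nonneg _ _ _ _) (hd.derivIter_pos k t).le))
      (Finset.mem_range.2 hk)
    simpa only [hone, one_mul] using this
  set s := stepFun c a m y with hs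
  have hsI : PeriodicIntegrable s := periodicIntegrable_stepFun _ _ _ _
  set s' : ℝ → ℝ := ∑ i ∈ range m, y i • P i with hs'
  have hs'I : PeriodicIntegrable s' := .sum _ fun i _ => (hPI i).smul _
  have hcob : IsCoboundary Φ (s' - s) := by
    have : s' - s = ∑ i ∈ range m, y i • (P i - χ i) := by
      simp only [hs', hs, stepFun, smul_sub, Finset.sum_sub_distrib, hχ]
    rw [this]
    exact .sum _ fun i _ => (hPcob i).smul _
  set A := ∫ t in c..c + 1, |ψ t| with hA
  have hψsI := (hψ.sub hsI).abs
  -- the step function has almost the same norm, and almost mean zero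
  have hnorm : ∑ i ∈ range m, |y i| * (a (i + 1) - a i) ≤ A + η / 4 := by
    rw [← integral_abs_stepFun hamono ha0 ham]
    calc ∫ t in c..c + 1, |s t| ≤ ∫ t in c..c + 1, (|ψ t| + |ψ t - s t|) := by
          refine intervalIntegral.integral_mono_on (by linarith)
            (hsI.abs.intervalIntegrable _ _) ((hψ.abs.add hψsI).intervalIntegrable _ _)
            fun t _ => ?_
          have := abs_sub_abs_le_abs_sub (s t) (ψ t)
          rw [abs_sub_comm] at this
          linarith
      _ = A + ∫ t in c..c + 1, |ψ t - s t| :=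
          intervalIntegral.integral_add (hψ.abs.intervalIntegrable _ _)
            (hψsI.intervalIntegrable _ _)
      _ ≤ _ := by linarith
  have hmean : |∑ i ∈ range m, y i * (a (i + 1) - a i)| ≤ η / 4 := by
    rw [← integral_stepFun hamono ha0 ham]
    have : ∫ t in c..c + 1, (ψ t - s t) = 0 - ∫ t in c..c + 1, s t := by
      rw [intervalIntegral.integral_sub (hψ.intervalIntegrable _ _) (hsI.intervalIntegrable _ _),
        hψ0]
    rw [zero_sub] at this
    rw [← abs_neg, ← this]
    exact (intervalIntegral.abs_integral_le_integral_abs (by linarith)).trans hy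
  have hpt : ∀ t, |s' t| ≤ ∑ i ∈ range m, |y i| * (P i t - δ * (a (i + 1) - a i)) + δ * (η / 4) := by
    intro t
    have e : s' t = ∑ i ∈ range m, y i * (P i t - δ * (a (i + 1) - a i))
        + δ * ∑ i ∈ range m, y i * (a (i + 1) - a i) := by
      rw [Finset.mul_sum, ← Finset.sum_add_distrib]
      simp only [hs', Finset.sum_apply, Pi.smul_apply, smul_eq_mul]
      exact Finset.sum_congr rfl fun i _ => by ring
    rw [e]
    refine (abs_add_le _ _).trans (add_le_add ?_ ?_)
    · refine (Finset.abs_sum_le_sum_abs _ _).trans (Finset.sum_le_sum fun i hi => ?_)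
      rw [abs_mul, abs_of_nonneg (a := P i t - _)
        (sub_nonneg.2 (hPlow i (Finset.mem_range.1 hi) t))]
    · rw [abs_mul, abs_of_pos hδ0]
      gcongr
  have hrI : ∀ i, IntervalIntegrable (fun t => P i t - δ * (a (i + 1) - a i)) volume c (c + 1) :=
    fun i => ((hPI i).intervalIntegrable _ _).sub intervalIntegrable_const
  have hsumI : IntervalIntegrable
      (fun t => ∑ i ∈ range m, |y i| * (P i t - δ * (a (i + 1) - a i))) volume c (c + 1) := by
    have e : (fun t => ∑ i ∈ range m, |y i| * (P i t - δ * (a (i + 1) - a i)))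
        = ∑ i ∈ range m, fun t => |y i| * (P i t - δ * (a (i + 1) - a i)) := by
      ext t
      simp only [Finset.sum_apply]
    rw [e]
    exact IntervalIntegrable.sum _ fun i _ => (hrI i).const_mul _
  have hs'norm : ∫ t in c..c + 1, |s' t| ≤ (1 - δ) * (A + η / 4) + δ * (η / 4) := by
    calc ∫ t in c..c + 1, |s' t|
        ≤ ∫ t in c..c + 1,
            (∑ i ∈ range m, |y i| * (P i t - δ * (a (i + 1) - a i)) + δ * (η / 4)) :=
          intervalIntegral.integral_mono_on (by linarith) (hs'I.abs.intervalIntegrable _ _)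
            (hsumI.add intervalIntegrable_const) fun t _ => hpt t
      _ = (1 - δ) * ∑ i ∈ range m, |y i| * (a (i + 1) - a i) + δ * (η / 4) := by
          rw [intervalIntegral.integral_add hsumI intervalIntegrable_const,
            intervalIntegral.integral_finsetSum fun i _ => (hrI i).const_mul _,
            intervalIntegral.integral_const, Finset.mul_sum]
          congr 1
          · refine Finset.sum_congr rfl fun i hi => ?_
            rw [intervalIntegral.integral_const_mul, intervalIntegral.integral_sub
              ((hPI i).intervalIntegrable _ _) intervalIntegrable_const,
              hPint i (Finset.mem_range.1 hi), intervalIntegral.integral_const]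
            simp only [add_sub_cancel_left, smul_eq_mul]
            ring
          · simp
      _ ≤ _ := by
          have := mul_le_mul_of_nonneg_left hnorm (sub_nonneg.2 hδ1)
          linarith
  refine ⟨(-1 : ℝ) • (s' - s), hcob.smul _, ?_⟩
  calc ∫ t in c..c + 1, |ψ t - ((-1 : ℝ) • (s' - s)) t|
      ≤ ∫ t in c..c + 1, (|ψ t - s t| + |s' t|) := by
        refine intervalIntegral.integral_mono_on (by linarith)
          ((hψ.sub ((hs'I.sub hsI).smul _)).abs.intervalIntegrable _ _)
          ((hψsI.add hs'I.abs).intervalIntegrable _ _) fun t _ => ?_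
        have : ψ t - ((-1 : ℝ) • (s' - s)) t = (ψ t - s t) + s' t := by
          simp only [Pi.smul_apply, Pi.sub_apply, smul_eq_mul]; ring
        rw [this]
        exact abs_add_le _ _
    _ = (∫ t in c..c + 1, |ψ t - s t|) + ∫ t in c..c + 1, |s' t| :=
        intervalIntegral.integral_add (hψsI.intervalIntegrable _ _)
          (hs'I.abs.intervalIntegrable _ _)
    _ ≤ η / 4 + ((1 - δ) * (A + η / 4) + δ * (η / 4)) := add_le_add hy hs'norm
    _ ≤ _ := by nlinarith

/-- Coboundaries are dense in mean among the densities of mean zero. By duality this is the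
ergodicity of `Φ` with respect to Lebesgue measure. -/
lemma IsC1BVDiffeo.exists_coboundary_approx (hd : IsC1BVDiffeo Φ)
    (hΦ : ∀ s, Φ (h s) = h (s + τ)) (hcont : Continuous h) (hmono : StrictMono h)
    (H : ∀ n, RotApprox τ (q n) (p n)) (hq : Tendsto q atTop atTop) {ψ : ℝ → ℝ}
    (hψ : PeriodicIntegrable ψ) (hψ0 : ∫ t in (0 : ℝ)..0 + 1, ψ t = 0) {ε : ℝ} (hε : 0 < ε) :
    ∃ u, IsCoboundary Φ u ∧ ∫ t in (0 : ℝ)..0 + 1, |ψ t - u t| < ε := by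
  obtain ⟨δ, hδ0, hδ1, hδ⟩ := hd.exists_coboundary_contraction hΦ hcont hmono H hq
  rw [hψ.integral_add_one_eq 0 (h 0)] at hψ0
  set N : (ℝ → ℝ) → ℝ := fun u => ∫ t in (h 0)..(h 0) + 1, |ψ t - u t| with hN
  have hN0 : ∀ u, 0 ≤ N u := fun u =>
    intervalIntegral.integral_nonneg (by linarith) fun _ _ => abs_nonneg _
  -- the infimum `d` of the distances to the coboundaries satisfies `d ≤ (1 - δ) * d`
  set D : Set ℝ := N '' {u | IsCoboundary Φ u} with hD
  have hbdd : BddBelow D := ⟨0, by rintro _ ⟨u, -, rfl⟩; exact hN0 u⟩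
  have hne : D.Nonempty := ⟨_, 0, IsCoboundary.zero, rfl⟩
  have hd0 : 0 ≤ sInf D := Real.sInf_nonneg (by rintro _ ⟨u, -, rfl⟩; exact hN0 u)
  have hstep : ∀ η > 0, sInf D ≤ (1 - δ) * (sInf D + η) + η := by
    intro η hη
    obtain ⟨_, ⟨u, hu, rfl⟩, hlt⟩ := exists_lt_of_csInf_lt hne (lt_add_of_pos_right (sInf D) hη)
    have huI := IsCoboundary.periodicIntegrable hd hu
    obtain ⟨u', hu', hle⟩ := hδ (ψ - u) (hψ.sub huI) (by
      simp only [Pi.sub_apply]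
      rw [intervalIntegral.integral_sub (hψ.intervalIntegrable _ _)
        (huI.intervalIntegrable _ _), hψ0, IsCoboundary.integral_eq_zero hd hu, sub_zero]) η hη
    have h1 : sInf D ≤ N (u + u') := csInf_le hbdd ⟨_, hu.add hu', rfl⟩
    have h2 : N (u + u') = ∫ t in (h 0)..(h 0) + 1, |(ψ - u) t - u' t| := by
      simp only [hN, Pi.add_apply, Pi.sub_apply, sub_sub]
    have h3 : (∫ t in (h 0)..(h 0) + 1, |(ψ - u) t|) = N u := by simp only [hN, Pi.sub_apply]
    rw [h3] at hle
    have h4 := mul_le_mul_of_nonneg_left hlt.le (sub_nonneg.2 hδ1)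
    linarith
  have hzero : sInf D = 0 := by
    refine le_antisymm (le_of_forall_pos_le_add fun η hη => ?_) hd0
    have := hstep (δ * η / 2) (by positivity)
    have h4 : (1 - δ) * (δ * η / 2) ≤ δ * η / 2 :=
      mul_le_of_le_one_left (by positivity) (by linarith)
    have h5 : δ * sInf D ≤ δ * η := by linarith
    have := le_of_mul_le_mul_left h5 hδ0
    linarith
  obtain ⟨_, ⟨u, hu, rfl⟩, hlt⟩ := exists_lt_of_csInf_lt hne (hzero.trans_lt hε)
  refine ⟨u, hu, ?_⟩
  have hI := (hψ.sub (IsCoboundary.periodicIntegrable hd hu)).abs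
  have := hI.integral_add_one_eq 0 (h 0)
  simp only [Pi.sub_apply] at this
  rw [this]
  exact hlt

end Contraction

/-! ### Birkhoff sums of smooth observables -/

section Smooth

variable {Φ h : CircleDeg1Lift} {τ : ℝ} {q : ℕ → ℕ} {p : ℕ → ℤ}

lemma DegreeControl.of_integral_abs {ψ : ℝ → ℝ} (hψ : PeriodicIntegrable ψ) :
    DegreeControl (fun x => ∫ t in (0 : ℝ)..x, |ψ t|) (∫ t in (0 : ℝ)..0 + 1, |ψ t|) where
  mono x y hxy := by
    have hI := hψ.abs.intervalIntegrable
    have := intervalIntegral.integral_interval_sub_left (hI 0 y) (hI 0 x)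
    have h0 : 0 ≤ ∫ t in x..y, |ψ t| :=
      intervalIntegral.integral_nonneg hxy fun _ _ => abs_nonneg _
    change _ ≤ _
    simp only
    linarith
  map_add_one x := by
    have hI := hψ.abs.intervalIntegrable
    rw [← intervalIntegral.integral_add_adjacent_intervals (hI 0 x) (hI x (x + 1)),
      hψ.abs.integral_add_one_eq x 0]

lemma PeriodicIntegrable.primitive_add_one {g : ℝ → ℝ} (hg : PeriodicIntegrable g) (x : ℝ) :
    ∫ t in (0 : ℝ)..x + 1, g t = (∫ t in (0 : ℝ)..x, g t) + ∫ t in (0 : ℝ)..0 + 1, g t := by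
  rw [← intervalIntegral.integral_add_adjacent_intervals (hg.intervalIntegrable 0 x)
    (hg.intervalIntegrable x (x + 1)), hg.integral_add_one_eq x 0]

/-- As `Φ^q - p` is nearly the identity for large `q`, so is its effect on a function `G` that
increases by a constant over each period. -/
lemma eventually_abs_map_iterate_sub_le (hΦ : ∀ s, Φ (h s) = h (s + τ)) (hcont : Continuous h)
    (H : ∀ n, RotApprox τ (q n) (p n)) (hq : Tendsto q atTop atTop) {G : ℝ → ℝ} {γ : ℝ}
    (hG : Continuous G) (hG1 : ∀ x, G (x + 1) = G x + γ) {ε : ℝ} (hε : 0 < ε) :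
    ∀ᶠ n in atTop, ∀ x, |G (Φ^[q n] x) - G x - γ * p n| ≤ ε := by
  have hu := (uniformContinuous_of_map_add_one hG hG1).comp
    (uniformContinuous_of_map_add_one hcont h.map_add_one)
  obtain ⟨κ, hκ, hclose⟩ := Metric.uniformContinuous_iff.1 hu ε hε
  have hlim : Tendsto (fun n => 1 / (q n : ℝ)) atTop (𝓝 0) :=
    tendsto_one_div_atTop_nhds_zero_nat.comp hq
  filter_upwards [hlim.eventually_lt_const hκ] with n hn x
  obtain ⟨θ, rfl⟩ := h.continuous_iff_surjective.1 hcont x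
  have e : Φ^[q n] (h θ) = h (θ + (q n * τ - p n)) + p n := by
    rw [iterate_semiconj hΦ, ← CircleDeg1Lift.map_add_int]
    congr 1; ring
  rw [e, map_add_int_of_map_add_one hG1]
  have := hclose (a := θ + (q n * τ - p n)) (b := θ) (by
    rw [Real.dist_eq, add_sub_cancel_left]
    exact (H n).abs_mul_sub_le.trans_lt hn)
  rw [Real.dist_eq] at this
  simp only [Function.comp] at this
  rw [add_sub_right_comm, add_sub_cancel_right]
  exact this.le

/-- Birkhoff sums of a `C^1` observable along the times `q n` have vanishing oscillation. Up to a
function of small variation the observable is `G ∘ Φ - G`, whose Birkhoff sums telescope. -/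
lemma IsC1BVDiffeo.eventually_abs_birkhoff_sub_le (hd : IsC1BVDiffeo Φ)
    (hΦ : ∀ s, Φ (h s) = h (s + τ)) (hcont : Continuous h) (hmono : StrictMono h)
    (H : ∀ n, RotApprox τ (q n) (p n)) (hq : Tendsto q atTop atTop) {f f' : ℝ → ℝ}
    (hf : ∀ x, HasDerivAt f (f' x) x) (hf' : Continuous f') (hper : ∀ x, f (x + 1) = f x)
    (hper' : ∀ x, f' (x + 1) = f' x) {ε : ℝ} (hε : 0 < ε) :
    ∀ᶠ n in atTop, ∀ x y,
      |∑ k ∈ range (q n), f (Φ^[k] x) - ∑ k ∈ range (q n), f (Φ^[k] y)| ≤ ε := by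
  have hfint : ∀ a b, ∫ t in a..b, f' t = f b - f a := fun a b =>
    intervalIntegral.integral_eq_sub_of_hasDerivAt (fun x _ => hf x) (hf'.intervalIntegrable _ _)
  have hψ : PeriodicIntegrable f' := ⟨hper', fun a b => hf'.intervalIntegrable a b⟩
  obtain ⟨_, ⟨g, hg, rfl⟩, hlt⟩ := hd.exists_coboundary_approx hΦ hcont hmono H hq hψ
    (by rw [hfint, hper, sub_self]) (show 0 < ε / 24 by positivity)
  have hTg := hd.periodicIntegrable_transfer hg
  have hrI := hψ.sub (hTg.sub hg)
  set G : ℝ → ℝ := fun x => ∫ t in (0 : ℝ)..x, g t with hG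
  have hGsub : ∀ x y, ∫ t in x..y, g t = G y - G x := fun x y =>
    (intervalIntegral.integral_interval_sub_left (hg.intervalIntegrable 0 y)
      (hg.intervalIntegrable 0 x)).symm
  have hG1 : ∀ x, G (x + 1) = G x + ∫ t in (0 : ℝ)..0 + 1, g t := hg.primitive_add_one
  have hGc : Continuous G :=
    intervalIntegral.continuous_primitive (fun a b => hg.intervalIntegrable a b) 0
  set R : ℝ → ℝ := fun x => f x - (G (Φ x) - G x) with hR
  have hR1 : ∀ x, R (x + 1) = R x := fun x => by
    simp only [hR, hper, Φ.map_add_one, hG1]; ring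
  have hRint : ∀ x y, R x - R y = ∫ t in y..x, (f' - (transfer Φ g - g)) t := fun x y => by
    simp only [Pi.sub_apply]
    rw [intervalIntegral.integral_sub (hf'.intervalIntegrable _ _)
      ((hTg.intervalIntegrable _ _).sub (hg.intervalIntegrable _ _)), intervalIntegral.integral_sub
      (hTg.intervalIntegrable _ _) (hg.intervalIntegrable _ _), hfint, hd.integral_transfer,
      hGsub, hGsub]
    ring
  have hV : 12 * (∫ t in (0 : ℝ)..0 + 1, |(f' - (transfer Φ g - g)) t|) ≤ ε / 2 :=
    (mul_le_mul_of_nonneg_left hlt.le (by norm_num)).trans_eq (by ring)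
  have hctl := DegreeControl.of_integral_abs hrI
  have hRv : ∀ x y, ‖R x - R y‖ ≤ |(∫ t in (0 : ℝ)..x, |(f' - (transfer Φ g - g)) t|)
      - (∫ t in (0 : ℝ)..y, |(f' - (transfer Φ g - g)) t|)| := fun x y => by
    rw [intervalIntegral.integral_interval_sub_left (hrI.abs.intervalIntegrable 0 x)
      (hrI.abs.intervalIntegrable 0 y), hRint]
    exact intervalIntegral.norm_integral_le_abs_integral_norm
  have hsplit : ∀ n x, ∑ k ∈ range n, f (Φ^[k] x)
      = ∑ k ∈ range n, R (Φ^[k] x) + (G (Φ^[n] x) - G x) := fun n x => by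
    have := Finset.sum_range_sub (fun k => G (Φ^[k] x)) n
    simp only [Function.iterate_zero, id] at this
    rw [← this, ← Finset.sum_add_distrib]
    refine Finset.sum_congr rfl fun k _ => ?_
    simp only [hR, Function.iterate_succ_apply']
    ring
  filter_upwards [eventually_abs_map_iterate_sub_le hΦ hcont H hq hGc hG1
    (show 0 < ε / 4 by positivity)] with n hn x y
  have h1 := abs_le.1 ((hctl.norm_birkhoff_sub_le hΦ (H n) hR1 hRv x y).trans hV)
  have h2 := abs_le.1 (hn x)
  have h3 := abs_le.1 (hn y)
  rw [hsplit, hsplit, abs_le]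
  constructor <;> linarith [h1.1, h1.2, h2.1, h2.2, h3.1, h3.2]

lemma re_unitExp (x : ℝ) : (unitExp x).re = Real.cos (2 * Real.pi * x) := by
  rw [unitExp_eq, Complex.exp_ofReal_mul_I_re]

lemma im_unitExp (x : ℝ) : (unitExp x).im = Real.sin (2 * Real.pi * x) := by
  rw [unitExp_eq, Complex.exp_ofReal_mul_I_im]

lemma IsC1BVDiffeo.eventually_norm_orbitVertex_sub_le (hd : IsC1BVDiffeo Φ)
    (hΦ : ∀ s, Φ (h s) = h (s + τ)) (hcont : Continuous h) (hmono : StrictMono h)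
    (H : ∀ n, RotApprox τ (q n) (p n)) (hq : Tendsto q atTop atTop) {ε : ℝ} (hε : 0 < ε) :
    ∀ᶠ n in atTop, ∀ x y, ‖orbitVertex Φ x (q n) - orbitVertex Φ y (q n)‖ ≤ ε := by
  have hre : ∀ x, (unitExp (x + 1)).re = (unitExp x).re := fun x => by rw [unitExp_add_one]
  have him : ∀ x, (unitExp (x + 1)).im = (unitExp x).im := fun x => by rw [unitExp_add_one]
  simp only [re_unitExp] at hre
  simp only [im_unitExp] at him
  have hlin : ∀ x : ℝ, HasDerivAt (fun x : ℝ => 2 * Real.pi * x) (2 * Real.pi) x := fun x => by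
    simpa using (hasDerivAt_id x).const_mul (2 * Real.pi)
  have hcos := hd.eventually_abs_birkhoff_sub_le hΦ hcont hmono H hq (fun x => (hlin x).cos)
    (by fun_prop) hre (fun x => by rw [him]) (half_pos hε)
  have hsin := hd.eventually_abs_birkhoff_sub_le hΦ hcont hmono H hq (fun x => (hlin x).sin)
    (by fun_prop) him (fun x => by rw [hre]) (half_pos hε)
  filter_upwards [hcos, hsin] with n h1 h2 x y
  refine (Complex.norm_le_abs_re_add_abs_im _).trans ?_
  simp only [orbitVertex_eq, Complex.sub_re, Complex.sub_im, Complex.re_sum, Complex.im_sum,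
    re_unitExp, im_unitExp]
  linarith [h1 x y, h2 x y]

end Smooth

end Curlicue

theorem proposition3p3
    (φ : Circle ≃ₜ Circle) (Φ : CircleDeg1Lift) (hΦ : Curlicue.IsLift φ Φ)
    (hirr : Irrational (Curlicue.rotationNumber Φ))
    (c : ℂ) (x₀ : ℝ)
    (hc : Filter.Tendsto (fun N : ℕ => (1 / (N : ℂ)) * Curlicue.orbitVertex Φ x₀ N)
      Filter.atTop (nhds c)) :
    (∃ M : ℝ, ∀ (n : ℕ) (x : ℝ),
      ‖Curlicue.orbitVertex Φ x (Curlicue.convDen (Curlicue.rotationNumber Φ) n)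
        - (Curlicue.convDen (Curlicue.rotationNumber Φ) n : ℂ) * c‖ ≤ M) ∧
    (Curlicue.IsC1BVDiffeo Φ →
      ∀ ε : ℝ, 0 < ε → ∃ N : ℕ, ∀ n : ℕ, N < n → ∀ x : ℝ,
        ‖Curlicue.orbitVertex Φ x (Curlicue.convDen (Curlicue.rotationNumber Φ) n)
          - (Curlicue.convDen (Curlicue.rotationNumber Φ) n : ℂ) * c‖ < ε) := by
  obtain ⟨h, hh⟩ := hΦ.exists_semiconj
  choose p H using Curlicue.exists_rotApprox_convDen hirr
  have hq := Curlicue.tendsto_convDen hirr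
  refine ⟨⟨12 * (2 * Real.pi), fun n x => Curlicue.norm_orbitVertex_sub_mul_le hc
    (Curlicue.norm_orbitVertex_sub_le hh (H n)) x⟩, fun hd ε hε => ?_⟩
  have hτ : Irrational Φ.translationNumber := by
    have := hirr.add_intCast ⌊Φ.translationNumber⌋
    rwa [Curlicue.rotationNumber, Int.fract_add_floor] at this
  have hcont := hd.continuous_conj hh H hq
  have hmono := Curlicue.strictMono_conj hτ hh rfl H hq
  obtain ⟨N, hN⟩ := Filter.eventually_atTop.1
    (hd.eventually_norm_orbitVertex_sub_le hh hcont hmono H hq (half_pos hε))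
  exact ⟨N, fun n hn x => (Curlicue.norm_orbitVertex_sub_mul_le hc (hN n hn.le) x).trans_lt
    (half_lt_self hε)⟩
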